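/- For a nonzero locally finite Borel measure $\mu$ on $\mathbb C$ that is doubling, i.e. for which there is a constant $C$ with $\mu(D(z,2r))\le C\,\mu(D(z,r))$ for all $z\in\mathbb C$ and $r>0$, let $\rho_\mu(z)$ denote the unique radius $\rho>0$ with $\mu(D(z,\rho))=1$. \textbf{Theorem.} Let $\phi:\mathbb C\to[-\infty,\infty)$ be a (nonharmonic) subharmonic function, $\phi\not\equiv-\infty$, whose distributional Laplacian $\Delta\phi$ is a nonzero doubling measure, and put $\rho_\phi=\rho_{\Delta\phi}$. Then there exist a subharmonic function $\psi\in\mathcal C^\infty(\mathbb C)$ and a constant $C>0$ such that 1. $|\psi(z)-\phi(z)|\le C$ for all $z\in\mathbb C$ (in particular $\phi>-\infty$ everywhere); 2. the measure $\Delta\psi$ (that is, $\Delta\psi(z)\,dm(z)$, with $m$ the Lebesgue measure) is doubling; 3. with $\rho_\psi=\rho_{\Delta\psi}$, we have $C^{-1}\rho_\psi(z)^{-2}\le\Delta\psi(z)\le C\rho_\psi(z)^{-2}$ and $C^{-1}\rho_\phi(z)^{-2}\le\rho_\psi(z)^{-2}\le C\rho_\phi(z)^{-2}$ for all $z\in\mathbb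 C$; 4. $|\nabla(\Delta\psi)(z)|\le C\rho_\phi(z)^{-3}$ for all $z\in\mathbb C$. -/

import Mathlib

open MeasureTheory
open scoped NNReal ENNReal ContDiff Laplacian InnerProductSpace

noncomputable section

/-- The mean of `u : ℂ → [-∞, ∞]` over the circle with centre `c` and radius `r`, i.e. the mean of
the positive part minus the mean of the negative part. For upper semicontinuous `u < ∞` the former
is finite, so that the mean is a well-defined element of `[-∞, ∞)`. -/
def circleMean (u : ℂ → EReal) (c : ℂ) (r : ℝ) : EReal :=
  (((∫⁻ θ in Set.Ioc 0 (2 * Real.pi), (u (circleMap c r θ)).toENNReal) /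
      ENNReal.ofReal (2 * Real.pi) : ℝ≥0∞) : EReal) -
  (((∫⁻ θ in Set.Ioc 0 (2 * Real.pi), (-u (circleMap c r θ)).toENNReal) /
      ENNReal.ofReal (2 * Real.pi) : ℝ≥0∞) : EReal)

/-- Subharmonic functions `ℂ → [-∞, ∞)`: upper semicontinuous, not identically `-∞`, and with
the sub-mean value property on every circle. -/
structure Subharmonic (u : ℂ → EReal) : Prop where
  lt_top : ∀ z, u z < ⊤
  not_bot : ∃ z, u z ≠ ⊥
  usc : UpperSemicontinuous u
  le_circleMean : ∀ (c : ℂ) (r : ℝ), 0 < r → u c ≤ circleMean u c r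

/-- The locally finite Borel measure `μ` is the Laplacian `Δu` of `u` in the sense of
distributions: `∫ u Δη dm = ∫ η dμ` for all real test functions `η`. (A subharmonic function takes
the value `-∞` on a Lebesgue null set only, so that `u` and `u.toReal` are the same
distribution.) -/
structure IsDistribLaplacian (u : ℂ → EReal) (μ : Measure ℂ) : Prop where
  locallyFinite : IsLocallyFiniteMeasure μ
  locallyIntegrable : LocallyIntegrable (fun z => (u z).toReal) volume
  integral_eq : ∀ η : ℂ → ℝ, ContDiff ℝ ∞ η → HasCompactSupport η →
    ∫ z, (u z).toReal * (Δ η) z = ∫ z, η z ∂μ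

/-- Doubling measures on `ℂ`. -/
def IsDoubling (μ : Measure ℂ) : Prop :=
  ∃ C : ℝ≥0, ∀ (z : ℂ) (r : ℝ), 0 < r →
    μ (Metric.ball z (2 * r)) ≤ C * μ (Metric.ball z r)

/-- The radius `ρ(z) > 0` with `μ(D(z, ρ(z))) = 1`. For a locally finite nonzero doubling measure
`μ` there is exactly one such radius, so the infimum is over a one-point set. -/
def massRadius (μ : Measure ℂ) (z : ℂ) : ℝ :=
  sInf {r : ℝ | 0 < r ∧ μ (Metric.ball z r) = 1}

/-- `f ≲ g`: there is a constant `C`, independent of the point, with `f ≤ C g`. -/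
def Lesssim (f g : ℂ → ℝ) : Prop :=
  ∃ C : ℝ, 0 < C ∧ ∀ z, f z ≤ C * g z

/-- `f ≃ g`: `f ≲ g` and `g ≲ f`. -/
def Comparable (f g : ℂ → ℝ) : Prop :=
  Lesssim f g ∧ Lesssim g f

end

/-!
The function `ψ` is obtained from `φ` by spreading out the mass `dμ(ζ)` of its Laplacian over a
disc of radius `ρ_μ(ζ) / 32` around `ζ`, with a smooth radial mollifier `bump` of mass `1`. The
scale depends on the source point `ζ` and not on the point `z` of evaluation, so that
`Δψ(z) = ∫ bump_{ρ_μ(ζ)/32}(z - ζ) dμ(ζ)` is nonnegative, and derivatives in `z` fall on the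
mollifier alone: no regularity of the radius `ρ_μ` beyond its Lipschitz continuity is needed.
Since the disc of radius `ρ_μ(z)` has mass `1` and `ρ_μ` is comparable to `ρ_μ(z)` on the disc of
half that radius, `Δψ` is comparable to `ρ_μ⁻²` and `∇Δψ` is bounded by a multiple of `ρ_μ⁻³`.

To have `ψ` smooth by construction, it is written as the mean of `φ` on the fixed scale `1` plus
`∫ potential(z - ζ, log (ρ_μ(ζ)/32)) dμ(ζ)`, where `potential(·, s)` is the smooth compactly
supported function whose Laplacian is the difference of the mollifiers on the scales `e ^ s` and
`1`. It is explicit: both mollifiers have radial logarithmic potentials, which agree far out.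
Testing the distributional Laplacian of `φ` with these functions gives `laplacian_regularization`
and the formula `IsDistribLaplacian.mollification_sub` for the dependence of the means of `φ` on
the scale.

The bound `|ψ - φ| ≤ C` combines three estimates. Freezing the variable scale at its value at `z`
changes `ψ(z)` by a bounded amount, as the potentials are Lipschitz in the logarithmic scale
(`abs_regularization_sub_mollification_le`). The mean of `φ` on that scale is at least `φ(z)` by
the sub-mean value property (`Subharmonic.le_mollification`). It exceeds `φ(z)` by at most a
constant (`Subharmonic.mollification_sub_le`): passing to a third of the scale costs a multiple of
the mass of the disc, those masses decay geometrically because doubling measures are reverse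
doubling, and on vanishing scales upper semicontinuity takes over.

Finally `Δψ dm` is doubling: on discs `D(z, R)` with `R ≥ ρ_μ(z) / 16` its mass lies between those
that `μ` gives to `D(z, R/4)` and `D(z, 3R)`, and on smaller discs its density is comparable to a
constant. The same inclusions show that the mass radii of the two measures are comparable.
-/

open Filter Topology Metric Set

set_option linter.unusedSectionVars false

/-! ### Differentiation of parametric integrals -/

section ParametricIntegral

variable {X E P F : Type} [TopologicalSpace X] [T2Space X] [SecondCountableTopology X]
  [MeasurableSpace X] [BorelSpace X] {ν : Measure X}
  [NormedAddCommGroup E] [NormedSpace ℝ E] [FiniteDimensional ℝ E]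
  [NormedAddCommGroup P] [NormedSpace ℝ P]
  [NormedAddCommGroup F] [NormedSpace ℝ F]

/-- The derivative of `Φ : E × P → F` in its first variable. -/
noncomputable def partialFDeriv (Φ : E × P → F) (q : E × P) : E →L[ℝ] F :=
  (fderiv ℝ Φ q).comp (ContinuousLinearMap.inl ℝ E P)

/-- The functions `x ↦ Φ (z, j x)` vanish off a compact set which is locally independent
of `z`, up to a null set of `ν`. -/
def LocallyCompactlySupported (ν : Measure X) (j : X → P) (Φ : E × P → F) : Prop :=
  ∀ z₀ : E, ∃ K : Set X, IsCompact K ∧ ∃ U : Set E, IsOpen U ∧ z₀ ∈ U ∧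
    ∀ᵐ x ∂ν, x ∉ K → ∀ z ∈ U, Φ (z, j x) = 0

theorem hasFDerivAt_partial {Φ : E × P → F} (hΦ : ContDiff ℝ ∞ Φ) (z : E) (p : P) :
    HasFDerivAt (fun z => Φ (z, p)) (partialFDeriv Φ (z, p)) z := by
  have h1 : HasFDerivAt Φ (fderiv ℝ Φ (z, p)) (z, p) :=
    (hΦ.differentiable (by simp)).differentiableAt.hasFDerivAt
  exact h1.comp z (hasFDerivAt_prodMk_left z p)

theorem ContDiff.partialFDeriv {Φ : E × P → F} (hΦ : ContDiff ℝ ∞ Φ) :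
    ContDiff ℝ ∞ (partialFDeriv Φ) :=
  (hΦ.fderiv_right (m := ∞) (by simp)).clm_comp contDiff_const

theorem partialFDeriv_eq_zero {Φ : E × P → F} (hΦ : ContDiff ℝ ∞ Φ) {U : Set E} (hU : IsOpen U)
    {p : P} (h : ∀ z ∈ U, Φ (z, p) = 0) {z : E} (hz : z ∈ U) : partialFDeriv Φ (z, p) = 0 := by
  have h0 : HasFDerivAt (fun z => Φ (z, p)) (0 : E →L[ℝ] F) z :=
    (hasFDerivAt_const (0 : F) z).congr_of_eventuallyEq
      (Filter.eventually_of_mem (hU.mem_nhds hz) h)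
  exact (hasFDerivAt_partial hΦ z p).unique h0

theorem LocallyCompactlySupported.partialFDeriv {j : X → P} {Φ : E × P → F}
    (hΦ : ContDiff ℝ ∞ Φ) (h : LocallyCompactlySupported ν j Φ) :
    LocallyCompactlySupported ν j (partialFDeriv Φ) := by
  intro z₀
  obtain ⟨K, hK, U, hU, hz₀, hz⟩ := h z₀
  exact ⟨K, hK, U, hU, hz₀, hz.mono fun x hx hxK z hzU =>
    partialFDeriv_eq_zero hΦ hU (hx hxK) hzU⟩

theorem LocallyCompactlySupported.integrable {g : X → ℝ} (hg : LocallyIntegrable g ν) {j : X → P}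
    (hj : Continuous j) {Φ : E × P → F} (hΦ : Continuous Φ)
    (h : LocallyCompactlySupported ν j Φ) (z : E) :
    Integrable (fun x => g x • Φ (z, j x)) ν := by
  obtain ⟨K, hK, U, hU, hz₀, hz⟩ := h z
  have h1 : IntegrableOn (fun x => g x • Φ (z, j x)) K ν :=
    (hg.integrableOn_isCompact hK).smul_continuousOn
      (hΦ.comp (continuous_const.prodMk hj)).continuousOn hK
  rw [← integrableOn_univ]
  refine h1.of_ae_sdiff_eq_zero nullMeasurableSet_univ ?_
  filter_upwards [hz] with x hx hxK
  rw [hx hxK.2 z hz₀, smul_zero]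

/-- Differentiation under the integral sign for smooth kernels of locally uniformly compact support.
The map `j` need only be continuous, so kernels that are rough in the integration variable are
allowed. -/
theorem hasFDerivAt_integral_param {g : X → ℝ} (hg : LocallyIntegrable g ν) {j : X → P}
    (hj : Continuous j) {Φ : E × P → F} (hΦ : ContDiff ℝ ∞ Φ)
    (h : LocallyCompactlySupported ν j Φ) (z₀ : E) :
    HasFDerivAt (fun z => ∫ x, g x • Φ (z, j x) ∂ν)
      (∫ x, g x • partialFDeriv Φ (z₀, j x) ∂ν) z₀ := by
  have hd := h.partialFDeriv hΦ
  obtain ⟨K, hK, U, hU, hz₀, hz⟩ := hd z₀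
  obtain ⟨ε, ε0, hε⟩ := Metric.nhds_basis_closedBall.mem_iff.1 (hU.mem_nhds hz₀)
  have hcomp : IsCompact (closedBall z₀ ε ×ˢ (j '' K)) :=
    (isCompact_closedBall z₀ ε).prod (hK.image hj)
  obtain ⟨C, hC⟩ := hcomp.exists_bound_of_continuousOn hΦ.partialFDeriv.continuous.continuousOn
  refine hasFDerivAt_integral_of_dominated_of_fderiv_le (s := closedBall z₀ ε)
    (F' := fun z x => g x • _root_.partialFDeriv Φ (z, j x))
    (bound := K.indicator fun x => ‖g x‖ * C) (closedBall_mem_nhds _ ε0)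
    (Eventually.of_forall fun z => (h.integrable hg hj hΦ.continuous z).aestronglyMeasurable)
    (h.integrable hg hj hΦ.continuous z₀)
    (hd.integrable hg hj hΦ.partialFDeriv.continuous z₀).aestronglyMeasurable ?_ ?_ ?_
  · filter_upwards [hz] with x hx z hz'
    by_cases hxK : x ∈ K
    · rw [indicator_of_mem hxK, norm_smul]
      gcongr
      exact hC _ ⟨hz', mem_image_of_mem j hxK⟩
    · rw [hx hxK z (hε hz'), indicator_of_notMem hxK]
      simp
  · exact (integrable_indicator_iff hK.measurableSet).2
      ((hg.integrableOn_isCompact hK).norm.mul_const C)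
  · exact Eventually.of_forall fun x z _ => (hasFDerivAt_partial hΦ z (j x)).const_smul (g x)

/-- The derivatives of the parametric integral are again integrals of the same kind, with values in
spaces of linear maps; hence the induction over all target spaces. -/
theorem contDiff_integral_param {g : X → ℝ} (hg : LocallyIntegrable g ν) {j : X → P}
    (hj : Continuous j) {Φ : E × P → F} (hΦ : ContDiff ℝ ∞ Φ)
    (h : LocallyCompactlySupported ν j Φ) :
    ContDiff ℝ ∞ (fun z => ∫ x, g x • Φ (z, j x) ∂ν) := by
  have key (n : ℕ) : ∀ {F : Type} [NormedAddCommGroup F] [NormedSpace ℝ F] {Φ : E × P → F},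
      ContDiff ℝ ∞ Φ → LocallyCompactlySupported ν j Φ →
      ContDiff ℝ n (fun z => ∫ x, g x • Φ (z, j x) ∂ν) := by
    induction n with
    | zero =>
      intro F _ _ Φ hΦ h
      exact contDiff_zero.2 (continuous_iff_continuousAt.2 fun z =>
        (hasFDerivAt_integral_param hg hj hΦ h z).continuousAt)
    | succ n ih =>
      intro F _ _ Φ hΦ h
      have h2 := ih hΦ.partialFDeriv (h.partialFDeriv hΦ)
      push_cast
      rw [contDiff_succ_iff_fderiv]
      refine ⟨fun z => (hasFDerivAt_integral_param hg hj hΦ h z).differentiableAt, by simp, ?_⟩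
      convert! h2 using 2 with z
      exact (hasFDerivAt_integral_param hg hj hΦ h z).fderiv
  exact contDiff_infty.2 fun n => key n hΦ h

theorem fderiv_integral_param {g : X → ℝ} (hg : LocallyIntegrable g ν) {j : X → P}
    (hj : Continuous j) {Φ : E × P → F} (hΦ : ContDiff ℝ ∞ Φ)
    (h : LocallyCompactlySupported ν j Φ) :
    fderiv ℝ (fun z => ∫ x, g x • Φ (z, j x) ∂ν) =
      fun z => ∫ x, g x • partialFDeriv Φ (z, j x) ∂ν :=
  funext fun z => (hasFDerivAt_integral_param hg hj hΦ h z).fderiv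

end ParametricIntegral

/-! ### The Laplacian on the plane -/

section Laplacian

theorem laplacian_eq_fderiv_fderiv (f : ℂ → ℝ) (z : ℂ) :
    (Δ f) z = fderiv ℝ (fderiv ℝ f) z 1 1 + fderiv ℝ (fderiv ℝ f) z Complex.I Complex.I := by
  rw [InnerProductSpace.laplacian_eq_iteratedFDeriv_complexPlane]
  simp [iteratedFDeriv_two_apply]

theorem ContDiff.laplacian_infty {f : ℂ → ℝ} (hf : ContDiff ℝ ∞ f) : ContDiff ℝ ∞ (Δ f) := by
  have h : ContDiff ℝ ∞ (fderiv ℝ (fderiv ℝ f)) :=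
    (hf.fderiv_right (m := ∞) (by simp)).fderiv_right (m := ∞) (by simp)
  rw [show Δ f = _ from funext (laplacian_eq_fderiv_fderiv f)]
  exact ((h.clm_apply contDiff_const).clm_apply contDiff_const).add
    ((h.clm_apply contDiff_const).clm_apply contDiff_const)

theorem laplacian_integral_param {X P : Type} [TopologicalSpace X] [T2Space X]
    [SecondCountableTopology X] [MeasurableSpace X] [BorelSpace X] {ν : Measure X}
    [NormedAddCommGroup P] [NormedSpace ℝ P] {g : X → ℝ} (hg : LocallyIntegrable g ν)
    {j : X → P} (hj : Continuous j) {Φ : ℂ × P → ℝ} (hΦ : ContDiff ℝ ∞ Φ)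
    (h : LocallyCompactlySupported ν j Φ) (z : ℂ) :
    (Δ (fun z => ∫ x, g x * Φ (z, j x) ∂ν)) z =
      ∫ x, g x * (Δ (fun z => Φ (z, j x))) z ∂ν := by
  have hf (p : P) (z : ℂ) : fderiv ℝ (fun z => Φ (z, p)) z = partialFDeriv Φ (z, p) :=
    (hasFDerivAt_partial hΦ z p).fderiv
  have hff (p : P) (z : ℂ) : fderiv ℝ (fderiv ℝ (fun z => Φ (z, p))) z =
      partialFDeriv (partialFDeriv Φ) (z, p) := by
    rw [show fderiv ℝ (fun z => Φ (z, p)) = fun z => partialFDeriv Φ (z, p) from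
      funext (hf p)]
    exact (hasFDerivAt_partial hΦ.partialFDeriv z p).fderiv
  have hΦ2 := hΦ.partialFDeriv
  have h2 := h.partialFDeriv hΦ
  have hint := (h2.partialFDeriv hΦ2).integrable hg hj hΦ2.partialFDeriv.continuous z
  simp_rw [← smul_eq_mul]
  rw [laplacian_eq_fderiv_fderiv, fderiv_integral_param hg hj hΦ h,
    fderiv_integral_param hg hj hΦ2 h2]
  simp_rw [laplacian_eq_fderiv_fderiv, hff]
  have happ (v : ℂ) : (∫ x, g x • partialFDeriv (partialFDeriv Φ) (z, j x) ∂ν) v v =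
      ∫ x, g x • partialFDeriv (partialFDeriv Φ) (z, j x) v v ∂ν := by
    rw [ContinuousLinearMap.integral_apply hint, ContinuousLinearMap.integral_apply
      (hint.apply_continuousLinearMap v)]
    rfl
  rw [happ, happ, ← integral_add]
  · simp_rw [smul_add]
  · exact (hint.apply_continuousLinearMap 1).apply_continuousLinearMap 1
  · exact (hint.apply_continuousLinearMap Complex.I).apply_continuousLinearMap Complex.I

/-- The Laplacian of a radial function: for `f = G (c |w|²)` with `G' = g`, in the variable
`a = c |w|²`. -/
theorem laplacian_radial {G g g' : ℝ → ℝ} (hG : ∀ a, HasDerivAt G (g a) a)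
    (hg : ∀ a, HasDerivAt g (g' a) a) (c : ℝ) (z₀ z : ℂ) :
    (Δ (fun w : ℂ => G (c * ‖w - z₀‖ ^ 2))) z =
      4 * c * (g (c * ‖z - z₀‖ ^ 2) + c * ‖z - z₀‖ ^ 2 * g' (c * ‖z - z₀‖ ^ 2)) := by
  have hq (w : ℂ) : HasFDerivAt (fun w : ℂ => c * ‖w - z₀‖ ^ 2)
      (c • (2 • innerSL ℝ (w - z₀))) w := by
    have := ((hasStrictFDerivAt_norm_sq (w - z₀)).hasFDerivAt.comp w
      ((hasFDerivAt_id w).sub_const z₀)).const_mul c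
    simpa using this
  have h1 : fderiv ℝ (fun w : ℂ => G (c * ‖w - z₀‖ ^ 2)) = fun w =>
      (g (c * ‖w - z₀‖ ^ 2)) • (c • (2 • innerSL ℝ (w - z₀))) := by
    funext w
    exact ((hG _).comp_hasFDerivAt w (hq w)).fderiv
  have h2 : HasFDerivAt (fun w : ℂ => c • (2 • innerSL ℝ (w - z₀)))
      (c • (2 • (innerSL ℝ : ℂ →L[ℝ] ℂ →L[ℝ] ℝ))) z :=
    ((((innerSL ℝ : ℂ →L[ℝ] ℂ →L[ℝ] ℝ).hasFDerivAt (x := z - z₀)).comp z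
      ((hasFDerivAt_id z).sub_const z₀)).const_smul 2).const_smul c
  have h3 := ((hg _).comp_hasFDerivAt z (hq z)).smul h2
  have h4 : fderiv ℝ (fun w : ℂ =>
      (g (c * ‖w - z₀‖ ^ 2)) • (c • (2 • innerSL ℝ (w - z₀)) : ℂ →L[ℝ] ℝ)) z = _ := h3.fderiv
  rw [laplacian_eq_fderiv_fderiv, h1, h4]
  have hn : ‖z - z₀‖ ^ 2 = (z - z₀).re ^ 2 + (z - z₀).im ^ 2 := by
    rw [← Complex.normSq_eq_norm_sq, Complex.normSq_apply]; ring
  have h11 : innerSL ℝ (1 : ℂ) 1 = 1 := by rw [innerSL_apply_apply]; simp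
  have hII : innerSL ℝ Complex.I Complex.I = 1 := by rw [innerSL_apply_apply]; simp
  simp only [Function.comp_apply, nsmul_eq_mul, Nat.cast_ofNat, _root_.add_apply,
    _root_.smul_apply, ContinuousLinearMap.smulRight_apply, smul_eq_mul, h11, hII,
    innerSL_apply_apply, Complex.inner]
  generalize g' (c * ‖z - z₀‖ ^ 2) = u
  generalize g (c * ‖z - z₀‖ ^ 2) = v
  rw [hn]
  simp
  ring

end Laplacian

/-! ### Mollifiers and their potentials -/

section Kernel

/-- A smooth nonincreasing cutoff on `ℝ`: `1` on `(-∞, 1/4]` and `0` on `[1, ∞)`. -/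
noncomputable def cutoff (a : ℝ) : ℝ := Real.smoothTransition (4 / 3 * (1 - a))

theorem contDiff_cutoff : ContDiff ℝ ∞ cutoff :=
  Real.smoothTransition.contDiff.comp (contDiff_const.mul (contDiff_const.sub contDiff_id))

theorem cutoff_eq_one {a : ℝ} (h : a ≤ 1 / 4) : cutoff a = 1 :=
  Real.smoothTransition.one_of_one_le (by linarith)

theorem cutoff_eq_zero {a : ℝ} (h : 1 ≤ a) : cutoff a = 0 :=
  Real.smoothTransition.zero_of_nonpos (by linarith)

theorem cutoff_nonneg (a : ℝ) : 0 ≤ cutoff a := Real.smoothTransition.nonneg _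

theorem cutoff_le_one (a : ℝ) : cutoff a ≤ 1 := Real.smoothTransition.le_one _

theorem antitone_cutoff : Antitone cutoff := fun a b h =>
  Real.smoothTransition.monotone (by linarith)

theorem hasDerivAt_cutoff (a : ℝ) : HasDerivAt cutoff (deriv cutoff a) a :=
  (contDiff_cutoff.differentiable (by simp)).differentiableAt.hasDerivAt

/-- The radial profile of the mollifiers, in the variable `a = |w|²`: minus the derivative of
the nonincreasing function `a ↦ (1 - a) * cutoff a`. -/
noncomputable def profile (a : ℝ) : ℝ := cutoff a - (1 - a) * deriv cutoff a

theorem contDiff_profile : ContDiff ℝ ∞ profile :=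
  contDiff_cutoff.sub ((contDiff_const.sub contDiff_id).mul
    (contDiff_cutoff.iterate_deriv 1))

theorem profile_eq_zero {a : ℝ} (h : 1 ≤ a) : profile a = 0 := by
  rw [profile, cutoff_eq_zero h]
  rcases h.eq_or_lt with rfl | h
  · simp
  · have h1 : cutoff =ᶠ[𝓝 a] fun _ => 0 := by
      filter_upwards [eventually_gt_nhds h] with x hx using cutoff_eq_zero hx.le
    rw [h1.deriv_eq]
    simp

theorem profile_nonneg (a : ℝ) : 0 ≤ profile a := by
  have h := antitone_cutoff.deriv_nonpos (x := a)
  rcases le_total a 1 with h1 | h1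
  · have := cutoff_nonneg a
    unfold profile
    nlinarith
  · exact (profile_eq_zero h1).ge

theorem profile_eq_one {a : ℝ} (h : a < 1 / 4) : profile a = 1 := by
  have h1 : cutoff =ᶠ[𝓝 a] fun _ => 1 := by
    filter_upwards [eventually_lt_nhds h] with x hx using cutoff_eq_one hx.le
  rw [profile, h1.deriv_eq, cutoff_eq_one h.le]
  simp

/-- `(1 - (1 - a) * cutoff a) / a`, which is smooth through `a = 0` because the cutoff is `1`
there. -/
noncomputable def potentialSlope (a : ℝ) : ℝ := (1 - cutoff a) / a + cutoff a

theorem mul_potentialSlope (a : ℝ) : a * potentialSlope a = 1 - (1 - a) * cutoff a := by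
  unfold potentialSlope
  rcases eq_or_ne a 0 with rfl | h
  · rw [cutoff_eq_one (by norm_num)]; simp
  · field_simp
    ring

theorem contDiff_potentialSlope : ContDiff ℝ ∞ potentialSlope := by
  rw [contDiff_iff_contDiffAt]
  intro a
  rcases lt_or_ge a (1 / 4) with h | h
  · have h1 : potentialSlope =ᶠ[𝓝 a] fun _ => 1 := by
      filter_upwards [eventually_lt_nhds h] with x hx
      simp [potentialSlope, cutoff_eq_one hx.le]
    exact contDiffAt_const.congr_of_eventuallyEq h1
  · exact ((contDiff_const.sub contDiff_cutoff).contDiffAt.div contDiffAt_id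
      (by simp; linarith)).add contDiff_cutoff.contDiffAt

/-- The radial potential, in the variable `a = |w|²`: a smooth function equal to `½ log a = log |w|`
for `a ≥ 1`. -/
noncomputable def radialPotential (a : ℝ) : ℝ := ∫ t in (1 : ℝ)..a, potentialSlope t / 2

theorem hasDerivAt_radialPotential (a : ℝ) :
    HasDerivAt radialPotential (potentialSlope a / 2) a :=
  intervalIntegral.integral_hasDerivAt_right
    ((contDiff_potentialSlope.continuous.div_const 2).intervalIntegrable _ _)
    ((contDiff_potentialSlope.continuous.div_const 2).stronglyMeasurableAtFilter _ _)
    (contDiff_potentialSlope.continuous.div_const 2).continuousAt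

theorem contDiff_radialPotential : ContDiff ℝ ∞ radialPotential := by
  have h : deriv radialPotential = fun a => potentialSlope a / 2 :=
    funext fun a => (hasDerivAt_radialPotential a).deriv
  rw [contDiff_infty_iff_deriv, h]
  exact ⟨fun a => (hasDerivAt_radialPotential a).differentiableAt,
    contDiff_potentialSlope.div_const 2⟩

theorem radialPotential_eq_log {a : ℝ} (h : 1 ≤ a) : radialPotential a = Real.log a / 2 := by
  have h1 : ∀ t ∈ uIcc 1 a, potentialSlope t / 2 = t⁻¹ / 2 := by
    intro t ht
    rw [uIcc_of_le h] at ht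
    rw [potentialSlope, cutoff_eq_zero ht.1]
    simp
  rw [radialPotential, intervalIntegral.integral_congr h1, intervalIntegral.integral_div,
    integral_inv_of_pos one_pos (by linarith)]
  simp

theorem hasDerivAt_potentialSlope (a : ℝ) :
    HasDerivAt potentialSlope (deriv potentialSlope a) a :=
  (contDiff_potentialSlope.differentiable (by simp)).differentiableAt.hasDerivAt

/-- Differentiating `a * potentialSlope a = 1 - (1 - a) * cutoff a`: the left side is, up to a
constant, the radial form of the Laplacian of the potential. -/
theorem potentialSlope_add_mul_deriv (a : ℝ) :
    potentialSlope a + a * deriv potentialSlope a = profile a := by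
  have h1 := (hasDerivAt_id a).mul (hasDerivAt_potentialSlope a)
  have h2 : HasDerivAt (fun a => 1 - (1 - a) * cutoff a)
      (-((0 - 1) * cutoff a + (1 - a) * deriv cutoff a)) a :=
    ((((hasDerivAt_const a (1 : ℝ)).sub (hasDerivAt_id a))).mul
      (hasDerivAt_cutoff a)).const_sub 1
  have h3 : (id * potentialSlope) = fun a => 1 - (1 - a) * cutoff a :=
    funext fun a => mul_potentialSlope a
  rw [h3] at h1
  have := h1.unique h2
  simp at this
  rw [this, profile]
  ring

/-- The total mass of the unnormalized mollifier `w ↦ profile (|w|²)`. -/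
noncomputable def profileMass : ℝ := ∫ w : ℂ, profile (‖w‖ ^ 2)

/-- The mollifier of total mass `1` on the scale `e ^ s`, as a smooth function of `(w, s)`. -/
noncomputable def bump (q : ℂ × ℝ) : ℝ :=
  profileMass⁻¹ * (Real.exp (-2 * q.2) * profile (Real.exp (-2 * q.2) * ‖q.1‖ ^ 2))

/-- The compactly supported potential of the difference of the mollifiers on the scales `e ^ s`
and `1`, as a smooth function of `(w, s)`. -/
noncomputable def potential (q : ℂ × ℝ) : ℝ :=
  (2 * profileMass)⁻¹ *
    (radialPotential (Real.exp (-2 * q.2) * ‖q.1‖ ^ 2) + q.2 - radialPotential (‖q.1‖ ^ 2))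

theorem contDiff_scaledNormSq :
    ContDiff ℝ ∞ (fun q : ℂ × ℝ => Real.exp (-2 * q.2) * ‖q.1‖ ^ 2) :=
  (Real.contDiff_exp.comp (contDiff_const.mul contDiff_snd)).mul
    ((contDiff_norm_sq ℝ).comp contDiff_fst)

theorem contDiff_bump : ContDiff ℝ ∞ bump :=
  contDiff_const.mul ((Real.contDiff_exp.comp (contDiff_const.mul contDiff_snd)).mul
    (contDiff_profile.comp contDiff_scaledNormSq))

theorem contDiff_potential : ContDiff ℝ ∞ potential :=
  contDiff_const.mul (((contDiff_radialPotential.comp contDiff_scaledNormSq).add contDiff_snd).sub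
    (contDiff_radialPotential.comp ((contDiff_norm_sq ℝ).comp contDiff_fst)))

theorem one_le_scaledNormSq {w : ℂ} {s : ℝ} (h : Real.exp s ≤ ‖w‖) :
    1 ≤ Real.exp (-2 * s) * ‖w‖ ^ 2 := by
  have h1 : Real.exp (-2 * s) * Real.exp s ^ 2 = 1 := by
    rw [sq, ← Real.exp_add, ← Real.exp_add, Real.exp_eq_one_iff]; ring
  rw [← h1]
  gcongr

theorem continuous_profile_norm_sq : Continuous (fun w : ℂ => profile (‖w‖ ^ 2)) :=
  contDiff_profile.continuous.comp (continuous_norm.pow 2)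

theorem profile_norm_sq_eq_zero {w : ℂ} (h : 1 ≤ ‖w‖) : profile (‖w‖ ^ 2) = 0 :=
  profile_eq_zero (one_le_pow₀ h)

theorem profileMass_pos : 0 < profileMass := by
  refine continuous_profile_norm_sq.integral_pos_of_hasCompactSupport_nonneg_nonzero
    (x := 0) (HasCompactSupport.intro (isCompact_closedBall 0 1) fun w hw =>
      profile_norm_sq_eq_zero (by simp at hw; exact hw.le)) (fun w => profile_nonneg _) ?_
  simp [profile_eq_one]

theorem bump_nonneg (q : ℂ × ℝ) : 0 ≤ bump q :=
  mul_nonneg (inv_nonneg.2 profileMass_pos.le)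
    (mul_nonneg (Real.exp_pos _).le (profile_nonneg _))

theorem bump_eq_zero {w : ℂ} {s : ℝ} (h : Real.exp s ≤ ‖w‖) : bump (w, s) = 0 := by
  rw [bump, profile_eq_zero (one_le_scaledNormSq h)]
  simp

theorem bump_eq_of_norm_lt {w : ℂ} {s : ℝ} (h : ‖w‖ < Real.exp s / 2) :
    bump (w, s) = profileMass⁻¹ * Real.exp (-2 * s) := by
  have h1 : Real.exp (-2 * s) * ‖w‖ ^ 2 < 1 / 4 := by
    have h1 : Real.exp (-2 * s) * (Real.exp s / 2) ^ 2 = 1 / 4 := by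
      rw [div_pow, sq, ← Real.exp_add, ← mul_div_assoc, ← Real.exp_add]
      ring_nf; simp
    rw [← h1]
    gcongr
  rw [bump, profile_eq_one h1, mul_one]

theorem scaledNormSq_eq_norm_smul (w : ℂ) (s : ℝ) :
    Real.exp (-2 * s) * ‖w‖ ^ 2 = ‖Real.exp (-s) • w‖ ^ 2 := by
  rw [norm_smul, mul_pow, Real.norm_eq_abs, abs_of_pos (Real.exp_pos _), ← Real.exp_nat_mul]
  push_cast
  ring_nf

theorem integral_bump (s : ℝ) : ∫ w, bump (w, s) = 1 := by
  simp_rw [bump, scaledNormSq_eq_norm_smul]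
  rw [integral_const_mul, integral_const_mul,
    Measure.integral_comp_smul volume (fun w : ℂ => profile (‖w‖ ^ 2)) (Real.exp (-s)),
    Complex.finrank_real_complex, ← Real.exp_nat_mul, abs_of_pos (inv_pos.2 (Real.exp_pos _)),
    ← Real.exp_neg, smul_eq_mul, ← mul_assoc (Real.exp _), ← Real.exp_add, ← profileMass]
  push_cast
  ring_nf
  rw [Real.exp_zero]
  field_simp [profileMass_pos.ne']

theorem hasDerivAt_radialPotential_scaled (a s : ℝ) :
    HasDerivAt (fun s => radialPotential (Real.exp (-2 * s) * a) + s)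
      ((1 - Real.exp (-2 * s) * a) * cutoff (Real.exp (-2 * s) * a)) s := by
  have h1 : HasDerivAt (fun s => Real.exp (-2 * s) * a) (Real.exp (-2 * s) * (-2 * 1) * a) s :=
    (((hasDerivAt_id s).const_mul (-2)).exp).mul_const a
  have h2 := ((hasDerivAt_radialPotential _).comp s h1).add (hasDerivAt_id s)
  convert! h2 using 1
  linear_combination mul_potentialSlope (Real.exp (-2 * s) * a)

/-- At a fixed point the potential increases with the scale, at bounded rate. -/
theorem potential_sub_mem {w : ℂ} {s s' : ℝ} (h : s' ≤ s) :
    potential (w, s) - potential (w, s') ∈ Icc 0 ((2 * profileMass)⁻¹ * (s - s')) := by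
  have hd (t : ℝ) := hasDerivAt_radialPotential_scaled (‖w‖ ^ 2) t
  have hm : Monotone (fun s => radialPotential (Real.exp (-2 * s) * ‖w‖ ^ 2) + s) := by
    refine monotone_of_deriv_nonneg (fun t => (hd t).differentiableAt) fun t => ?_
    rw [(hd t).deriv]
    rcases le_total 1 (Real.exp (-2 * t) * ‖w‖ ^ 2) with h | h
    · rw [cutoff_eq_zero h, mul_zero]
    · exact mul_nonneg (by linarith) (cutoff_nonneg _)
  have hd' (t : ℝ) := (hasDerivAt_id t).sub (hd t)
  have hm' : Monotone (id - fun s => radialPotential (Real.exp (-2 * s) * ‖w‖ ^ 2) + s) := by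
    refine monotone_of_deriv_nonneg (fun t => (hd' t).differentiableAt) fun t => ?_
    rw [(hd' t).deriv]
    have h0 : 0 ≤ Real.exp (-2 * t) * ‖w‖ ^ 2 := by positivity
    have h1 := cutoff_nonneg (Real.exp (-2 * t) * ‖w‖ ^ 2)
    have h2 := cutoff_le_one (Real.exp (-2 * t) * ‖w‖ ^ 2)
    nlinarith
  have h1 := hm h
  have h2 := hm' h
  simp only [Pi.sub_apply, id] at h1 h2
  have hp : 0 ≤ (2 * profileMass)⁻¹ := inv_nonneg.2 (by linarith [profileMass_pos])
  unfold potential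
  rw [← mul_sub]
  exact ⟨mul_nonneg hp (by linarith), mul_le_mul_of_nonneg_left (by linarith) hp⟩

theorem radialPotential_scaled_eq_log {w : ℂ} {s : ℝ} (hw : Real.exp s ≤ ‖w‖) :
    radialPotential (Real.exp (-2 * s) * ‖w‖ ^ 2) + s = Real.log ‖w‖ := by
  have h0 : ‖w‖ ≠ 0 := ((Real.exp_pos s).trans_le hw).ne'
  rw [radialPotential_eq_log (one_le_scaledNormSq hw),
    Real.log_mul (Real.exp_pos _).ne' (pow_ne_zero 2 h0), Real.log_exp, Real.log_pow]
  push_cast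
  ring

/-- Outside both discs the two radial potentials are the same logarithm. -/
theorem potential_eq_of_le {w : ℂ} {s s' : ℝ} (hs : Real.exp s ≤ ‖w‖) (hs' : Real.exp s' ≤ ‖w‖) :
    potential (w, s) = potential (w, s') := by
  simp only [potential, radialPotential_scaled_eq_log hs, radialPotential_scaled_eq_log hs']

theorem potential_eq_zero {w : ℂ} {s : ℝ} (hs : Real.exp s ≤ ‖w‖) (hw : 1 ≤ ‖w‖) :
    potential (w, s) = 0 := by
  rw [potential_eq_of_le hs (s' := 0) (by simpa using hw)]
  simp [potential]

theorem laplacian_radialPotential (c : ℝ) (z₀ z : ℂ) :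
    (Δ (fun w => radialPotential (c * ‖w - z₀‖ ^ 2))) z =
      2 * (c * profile (c * ‖z - z₀‖ ^ 2)) := by
  rw [laplacian_radial hasDerivAt_radialPotential
    (fun a => (hasDerivAt_potentialSlope a).div_const 2), ← potentialSlope_add_mul_deriv]
  ring

/-- The Laplacian of the potential is the difference of the mollifiers on the scales `e ^ s` and
`1`. -/
theorem laplacian_potential (s : ℝ) (z₀ z : ℂ) :
    (Δ (fun w => potential (w - z₀, s))) z = bump (z - z₀, s) - bump (z - z₀, 0) := by
  have hc (c : ℝ) : ContDiff ℝ 2 (fun w : ℂ => radialPotential (c * ‖w - z₀‖ ^ 2)) :=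
    (contDiff_infty.1 contDiff_radialPotential 2).comp
      (contDiff_const.mul ((contDiff_norm_sq ℝ).comp (contDiff_id.sub contDiff_const)))
  have h : (fun w => potential (w - z₀, s)) = (2 * profileMass)⁻¹ •
      (((fun w : ℂ => radialPotential (Real.exp (-2 * s) * ‖w - z₀‖ ^ 2)) + fun _ => s) -
        fun w : ℂ => radialPotential (1 * ‖w - z₀‖ ^ 2)) := by
    funext w
    simp [potential]
  have h1 : ContDiffAt ℝ 2 ((fun w : ℂ => radialPotential (Real.exp (-2 * s) * ‖w - z₀‖ ^ 2)) +
      fun _ => s) z := (hc _).contDiffAt.add contDiffAt_const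
  have h2 : ContDiffAt ℝ 2 (((fun w : ℂ => radialPotential (Real.exp (-2 * s) * ‖w - z₀‖ ^ 2)) +
      fun _ => s) - fun w : ℂ => radialPotential (1 * ‖w - z₀‖ ^ 2)) z :=
    h1.sub (hc 1).contDiffAt
  rw [h, InnerProductSpace.laplacian_smul _ h2,
    h1.laplacian_sub (hc 1).contDiffAt, (hc _).contDiffAt.laplacian_add contDiffAt_const,
    laplacian_radialPotential, laplacian_radialPotential, bump, bump]
  simp
  field_simp [profileMass_pos.ne']

end Kernel

/-! ### Doubling measures and the mass radius -/

section Doubling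

variable {μ : Measure ℂ}

theorem measure_ball_two_pow_le {C : ℝ≥0}
    (hC : ∀ (z : ℂ) (r : ℝ), 0 < r → μ (ball z (2 * r)) ≤ C * μ (ball z r)) (n : ℕ) (z : ℂ)
    {r : ℝ} (hr : 0 < r) : μ (ball z (2 ^ n * r)) ≤ C ^ n * μ (ball z r) := by
  induction n with
  | zero => simp
  | succ n ih =>
    calc μ (ball z (2 ^ (n + 1) * r)) = μ (ball z (2 * (2 ^ n * r))) := by ring_nf
      _ ≤ C * μ (ball z (2 ^ n * r)) := hC _ _ (by positivity)
      _ ≤ C * (C ^ n * μ (ball z r)) := by gcongr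
      _ = C ^ (n + 1) * μ (ball z r) := by ring

theorem IsDoubling.measure_ball_pos (hd : IsDoubling μ) (h0 : μ ≠ 0) (z : ℂ) {r : ℝ}
    (hr : 0 < r) : 0 < μ (ball z r) := by
  obtain ⟨C, hC⟩ := hd
  refine pos_iff_ne_zero.2 fun h => h0 ?_
  have h1 (n : ℕ) : μ (ball z (2 ^ n * r)) = 0 := by
    simpa [h] using measure_ball_two_pow_le hC n z hr
  have h2 : (⋃ n : ℕ, ball z (2 ^ n * r)) = univ := by
    refine eq_univ_of_forall fun w => mem_iUnion.2 ?_
    obtain ⟨n, hn⟩ := pow_unbounded_of_one_lt (dist w z / r) one_lt_two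
    exact ⟨n, by rwa [mem_ball, ← div_lt_iff₀ hr]⟩
  rw [← Measure.measure_univ_eq_zero, ← h2]
  exact measure_iUnion_null h1

/-- Doubling measures on the plane are reverse doubling: a disc and a disjoint comparable one both
lie in the dilated disc. -/
theorem IsDoubling.exists_reverse [IsLocallyFiniteMeasure μ] (hd : IsDoubling μ) :
    ∃ γ : ℝ, 0 ≤ γ ∧ γ < 1 ∧ ∀ (z : ℂ) (r : ℝ), 0 < r →
      μ.real (ball z r) ≤ γ * μ.real (ball z (3 * r)) := by
  obtain ⟨C, hC⟩ := hd
  have hC0 := C.coe_nonneg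
  refine ⟨C ^ 2 / (1 + C ^ 2), by positivity, (div_lt_one (by positivity)).2 (by linarith),
    fun z r hr => ?_⟩
  -- the disc `D(z, r)` lies in the fourfold dilate of the disjoint disc `D(z + 2r, r)`
  have h1 : μ.real (ball z r) ≤ C ^ 2 * μ.real (ball (z + (2 * r : ℝ)) r) := by
    have h : μ (ball z r) ≤ C ^ 2 * μ (ball (z + (2 * r : ℝ)) r) := by
      refine (measure_mono (ball_subset_ball' ?_)).trans (measure_ball_two_pow_le hC 2 _ hr)
      rw [dist_self_add_right, Complex.norm_real, Real.norm_eq_abs, abs_of_pos (by linarith)]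
      linarith
    have := ENNReal.toReal_mono (ENNReal.mul_ne_top (by simp) measure_ball_lt_top.ne) h
    simpa [Measure.real] using this
  have h2 : μ.real (ball z r) + μ.real (ball (z + (2 * r : ℝ)) r) ≤ μ.real (ball z (3 * r)) := by
    have hdist : dist z (z + (2 * r : ℝ)) = 2 * r := by
      rw [dist_self_add_right, Complex.norm_real, Real.norm_eq_abs, abs_of_pos (by linarith)]
    rw [← measureReal_union (ball_disjoint_ball (by rw [hdist]; linarith)) measurableSet_ball
      measure_ball_lt_top.ne measure_ball_lt_top.ne]
    refine measureReal_mono (union_subset (ball_subset_ball (by linarith))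
      (ball_subset_ball' (by rw [dist_comm, hdist]; linarith))) measure_ball_lt_top.ne
  rw [div_mul_eq_mul_div, le_div_iff₀ (by positivity)]
  nlinarith [sq_nonneg (C : ℝ)]

theorem IsDoubling.isUnifLocDoublingMeasure (hd : IsDoubling μ) :
    IsUnifLocDoublingMeasure μ := by
  obtain ⟨C, hC⟩ := hd
  refine ⟨C ^ 2, ?_⟩
  filter_upwards [self_mem_nhdsWithin] with ε (hε : 0 < ε) x
  calc μ (closedBall x (2 * ε)) ≤ μ (ball x (2 ^ 2 * ε)) :=
        measure_mono (closedBall_subset_ball (by linarith))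
    _ ≤ C ^ 2 * μ (ball x ε) := measure_ball_two_pow_le hC 2 x hε
    _ ≤ ((C ^ 2 : ℝ≥0) : ℝ≥0∞) * μ (closedBall x ε) := by
        push_cast
        gcongr
        exact ball_subset_closedBall

/-- Circles are null sets of doubling measures: at none of their points can they have
density `1`, since they miss comparable discs nearby. -/
theorem IsDoubling.measure_sphere [IsLocallyFiniteMeasure μ] (hd : IsDoubling μ) (z : ℂ)
    {r : ℝ} (hr : 0 ≤ r) : μ (sphere z r) = 0 := by
  have := hd.isUnifLocDoublingMeasure
  have h := (IsUnifLocDoublingMeasure.ae_tendsto_measure_inter_div μ (sphere z r) 2)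
  rw [ae_restrict_iff' isClosed_sphere.measurableSet] at h
  refine measure_eq_zero_iff_ae_notMem.2 (h.mono fun x hx hxs => ?_)
  obtain ⟨u, hu, hxu⟩ : ∃ u : ℂ, ‖u‖ = 1 ∧ x = z + r * u := by
    have hxr : ‖x - z‖ = r := by simpa [dist_eq_norm] using hxs
    rcases hr.eq_or_lt with rfl | hr
    · exact ⟨1, by simp, by simpa [sub_eq_zero] using hxr⟩
    · refine ⟨(x - z) / r, by simp [hxr, abs_of_pos hr, hr.ne'], ?_⟩
      have : (r : ℂ) ≠ 0 := by exact_mod_cast hr.ne'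
      field_simp
      ring
  have hδ : Tendsto (fun δ : ℝ => δ) (𝓝[>] 0) (𝓝[>] 0) := tendsto_id
  -- discs of radius `δ` pushed off the circle along the outward direction `u`
  have h1 := hx hxs (fun δ : ℝ => x + (2 * δ : ℝ) * u) _ hδ (by
    filter_upwards [self_mem_nhdsWithin] with δ (hδ : 0 < δ)
    rw [mem_closedBall, dist_self_add_right, norm_mul, hu, Complex.norm_real, Real.norm_eq_abs,
      abs_of_pos (by linarith), mul_one])
  have h2 : Tendsto (fun δ : ℝ => μ (sphere z r ∩ closedBall (x + (2 * δ : ℝ) * u) δ) /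
      μ (closedBall (x + (2 * δ : ℝ) * u) δ)) (𝓝[>] 0) (𝓝 0) := by
    refine tendsto_const_nhds.congr' ?_
    filter_upwards [self_mem_nhdsWithin] with δ (hδ : 0 < δ)
    have : sphere z r ∩ closedBall (x + (2 * δ : ℝ) * u) δ = ∅ := by
      refine eq_empty_of_forall_notMem fun y hy => ?_
      have h3 : dist (x + (2 * δ : ℝ) * u) z = r + 2 * δ := by
        rw [dist_eq_norm, hxu, show z + r * u + (2 * δ : ℝ) * u - z = ((r + 2 * δ : ℝ) : ℂ) * u by
          push_cast; ring, norm_mul, hu, mul_one, Complex.norm_real, Real.norm_eq_abs,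
          abs_of_pos (by linarith)]
      have h4 := dist_triangle_left (x + (2 * δ : ℝ) * u) z y
      have h5 : dist y z = r := hy.1
      have h6 : dist y (x + (2 * δ : ℝ) * u) ≤ δ := hy.2
      linarith
    rw [this, measure_empty, ENNReal.zero_div]
  exact zero_ne_one (tendsto_nhds_unique h2 h1)

theorem IsDoubling.continuous_measureReal_ball [IsLocallyFiniteMeasure μ] (hd : IsDoubling μ)
    (z : ℂ) : Continuous fun r : ℝ => μ.real (ball z r) := by
  refine continuous_iff_continuousAt.2 fun r₀ => ?_
  have h (r : ℝ) : μ.real (ball z r) = ∫ w, (ball z r).indicator 1 w ∂μ :=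
    (integral_indicator_one measurableSet_ball).symm
  simp_rw [h]
  refine continuousAt_of_dominated (bound := (ball z (r₀ + 1)).indicator 1)
    (Eventually.of_forall fun r =>
      (stronglyMeasurable_one.indicator measurableSet_ball).aestronglyMeasurable) ?_
    ((integrable_indicator_iff measurableSet_ball).2 (integrableOn_const measure_ball_lt_top.ne))
    ?_
  · filter_upwards [eventually_lt_nhds (lt_add_one r₀)] with r hr
    refine Eventually.of_forall fun w => ?_
    rw [norm_indicator_eq_indicator_norm]
    have h1 := indicator_le_indicator_of_subset (f := (1 : ℂ → ℝ))
      (ball_subset_ball (x := z) hr.le) (fun _ => zero_le_one) w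
    convert! h1 using 2
    ext
    simp
  · have hs : ∀ᵐ w ∂μ, dist w z ≠ r₀ := by
      rcases le_or_gt 0 r₀ with h0 | h0
      · filter_upwards [measure_eq_zero_iff_ae_notMem.1 (hd.measure_sphere z h0)] with w hw
        exact hw
      · exact Eventually.of_forall fun w => (h0.trans_le dist_nonneg).ne'
    filter_upwards [hs] with w hw
    refine ContinuousAt.congr (f := fun _ => (ball z r₀).indicator (1 : ℂ → ℝ) w)
      continuousAt_const ?_
    rcases lt_or_gt_of_ne hw with h1 | h1
    · filter_upwards [eventually_gt_nhds h1] with r hr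
      rw [indicator_of_mem (mem_ball.2 h1), indicator_of_mem (mem_ball.2 hr)]
    · filter_upwards [eventually_lt_nhds h1] with r hr
      rw [indicator_of_notMem (by simpa using h1.le), indicator_of_notMem (by simpa using hr.le)]

theorem measure_ball_le_pow {γ : ℝ} (hγ0 : 0 ≤ γ)
    (hγ : ∀ (z : ℂ) (r : ℝ), 0 < r → μ.real (ball z r) ≤ γ * μ.real (ball z (3 * r)))
    (z : ℂ) {r : ℝ} (hr : 0 < r) (n : ℕ) :
    μ.real (ball z r) ≤ γ ^ n * μ.real (ball z (3 ^ n * r)) := by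
  induction n with
  | zero => simp
  | succ n ih =>
    refine ih.trans ?_
    rw [pow_succ, mul_assoc]
    refine mul_le_mul_of_nonneg_left ((hγ z _ (by positivity)).trans_eq ?_) (by positivity)
    rw [pow_succ]; ring_nf

variable [IsLocallyFiniteMeasure μ]

theorem IsDoubling.exists_measureReal_ball_eq_one (hd : IsDoubling μ) {z : ℂ} {R : ℝ}
    (hR : 1 ≤ μ.real (ball z R)) : ∃ r, 0 < r ∧ r ≤ R ∧ μ.real (ball z r) = 1 := by
  have hR0 : 0 < R := by
    by_contra! h
    rw [ball_eq_empty.2 h] at hR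
    simp at hR
    linarith
  obtain ⟨r, hr, hr1⟩ := intermediate_value_Icc hR0.le
    (hd.continuous_measureReal_ball z).continuousOn (show (1 : ℝ) ∈ Icc _ _ from ⟨by simp, hR⟩)
  refine ⟨r, hr.1.lt_of_ne ?_, hr.2, hr1⟩
  rintro rfl
  simp at hr1

theorem setOf_measure_ball_eq_one (μ : Measure ℂ) (z : ℂ) :
    {r : ℝ | 0 < r ∧ μ (ball z r) = 1} = {r : ℝ | μ.real (ball z r) = 1} := by
  ext r
  simp only [mem_ofPred_eq]
  constructor
  · rintro ⟨-, h⟩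
    simp [Measure.real, h]
  · intro h
    refine ⟨?_, (ENNReal.toReal_eq_one_iff _).1 h⟩
    by_contra! h'
    simp [ball_eq_empty.2 h'] at h

theorem IsDoubling.exists_one_le (hd : IsDoubling μ) (h0 : μ ≠ 0) (z : ℂ) :
    ∃ R, 1 ≤ μ.real (ball z R) := by
  obtain ⟨γ, hγ0, hγ1, hγ⟩ := hd.exists_reverse
  have hpos : 0 < μ.real (ball z 1) :=
    ENNReal.toReal_pos (hd.measure_ball_pos h0 z one_pos).ne' measure_ball_lt_top.ne
  obtain ⟨n, hn⟩ := exists_pow_lt_of_lt_one hpos hγ1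
  refine ⟨3 ^ n * 1, ?_⟩
  have h1 := measure_ball_le_pow hγ0 hγ z one_pos n
  have h2 : (0 : ℝ) ≤ γ ^ n := by positivity
  by_contra! h
  nlinarith

theorem IsDoubling.massRadius_mem (hd : IsDoubling μ) (h0 : μ ≠ 0) (z : ℂ) :
    massRadius μ z ∈ {r : ℝ | 0 < r ∧ μ (ball z r) = 1} := by
  refine IsClosed.csInf_mem ?_ ?_ ⟨0, fun r hr => hr.1.le⟩
  · rw [setOf_measure_ball_eq_one]
    exact isClosed_eq (hd.continuous_measureReal_ball z) continuous_const
  · obtain ⟨R, hR⟩ := hd.exists_one_le h0 z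
    obtain ⟨r, -, -, hr1⟩ := hd.exists_measureReal_ball_eq_one hR
    rw [setOf_measure_ball_eq_one]
    exact ⟨r, hr1⟩

theorem IsDoubling.massRadius_pos (hd : IsDoubling μ) (h0 : μ ≠ 0) (z : ℂ) :
    0 < massRadius μ z := (hd.massRadius_mem h0 z).1

theorem IsDoubling.measure_ball_massRadius (hd : IsDoubling μ) (h0 : μ ≠ 0) (z : ℂ) :
    μ (ball z (massRadius μ z)) = 1 := (hd.massRadius_mem h0 z).2

theorem IsDoubling.massRadius_le (hd : IsDoubling μ) {z : ℂ} {R : ℝ}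
    (hR : 1 ≤ μ (ball z R)) : massRadius μ z ≤ R := by
  obtain ⟨r, hr0, hrR, hr1⟩ := hd.exists_measureReal_ball_eq_one (z := z) (R := R) (by
    rw [Measure.real, ← ENNReal.toReal_one]
    exact ENNReal.toReal_mono measure_ball_lt_top.ne hR)
  have hr : r ∈ {r : ℝ | 0 < r ∧ μ (ball z r) = 1} :=
    ⟨hr0, (ENNReal.toReal_eq_one_iff _).1 hr1⟩
  exact (csInf_le ⟨0, fun r hr => hr.1.le⟩ hr).trans hrR

theorem IsDoubling.le_massRadius (hd : IsDoubling μ) (h0 : μ ≠ 0) {z : ℂ} {R : ℝ}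
    (hR : μ (ball z R) < 1) : R ≤ massRadius μ z := by
  by_contra! h
  have := hR.trans_le' (measure_mono (ball_subset_ball h.le))
  rw [hd.measure_ball_massRadius h0 z] at this
  exact lt_irrefl _ this

theorem IsDoubling.massRadius_le_add_dist (hd : IsDoubling μ) (h0 : μ ≠ 0) (z w : ℂ) :
    massRadius μ z ≤ massRadius μ w + dist z w := by
  refine hd.massRadius_le ?_
  rw [← hd.measure_ball_massRadius h0 w]
  exact measure_mono (ball_subset_ball' (by rw [dist_comm w z]))

theorem IsDoubling.continuous_massRadius (hd : IsDoubling μ) (h0 : μ ≠ 0) :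
    Continuous (massRadius μ) :=
  (LipschitzWith.of_le_add (hd.massRadius_le_add_dist h0)).continuous

end Doubling

/-! ### Weighted means of a subharmonic function -/

section Mollification

theorem bump_sub_comm (z w : ℂ) (s : ℝ) : bump (z - w, s) = bump (w - z, s) := by
  simp only [bump, norm_sub_rev z w]

theorem potential_sub_comm (z w : ℂ) (s : ℝ) : potential (z - w, s) = potential (w - z, s) := by
  simp only [potential, norm_sub_rev z w]

/-- Kernels `Φ (z - ζ, s ζ)` are compactly supported in `ζ` locally uniformly in `z`, provided that
the scale `e ^ s(ζ)` grows at most like `|ζ| / 2`. -/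
theorem locallyCompactlySupported_translate {F : Type} [NormedAddCommGroup F] [NormedSpace ℝ F]
    {Φ : ℂ × ℝ → F} (hΦ : ∀ w s, Real.exp s ≤ ‖w‖ → 1 ≤ ‖w‖ → Φ (w, s) = 0) (ν : Measure ℂ)
    {s : ℂ → ℝ} {A : ℝ} (hs : ∀ ζ, Real.exp (s ζ) ≤ A + ‖ζ‖ / 2) :
    LocallyCompactlySupported ν (fun ζ => (ζ, s ζ))
      (fun q : ℂ × (ℂ × ℝ) => Φ (q.1 - q.2.1, q.2.2)) := by
  intro z₀
  refine ⟨closedBall 0 (2 * (‖z₀‖ + 1 + |A| + 1)), isCompact_closedBall _ _, ball z₀ 1, isOpen_ball,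
    mem_ball_self one_pos, Eventually.of_forall fun ζ hζ z hz => ?_⟩
  have h1 : 2 * (‖z₀‖ + 1 + |A| + 1) < ‖ζ‖ := by simpa using hζ
  have h2 : ‖z‖ ≤ ‖z₀‖ + 1 := by
    have := norm_le_norm_add_norm_sub' z z₀
    have h3 : ‖z - z₀‖ < 1 := by simpa [dist_eq_norm] using hz
    linarith
  have h3 : ‖ζ‖ - ‖z‖ ≤ ‖z - ζ‖ := by
    rw [norm_sub_rev]
    exact norm_sub_norm_le ζ z
  have h4 := hs ζ
  have h5 := le_abs_self A
  have h6 := abs_nonneg A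
  have h7 := norm_nonneg z₀
  exact hΦ _ _ (by linarith) (by linarith)

theorem contDiff_translate {F : Type} [NormedAddCommGroup F] [NormedSpace ℝ F]
    {Φ : ℂ × ℝ → F} (hΦ : ContDiff ℝ ∞ Φ) :
    ContDiff ℝ ∞ (fun q : ℂ × (ℂ × ℝ) => Φ (q.1 - q.2.1, q.2.2)) :=
  hΦ.comp ((contDiff_fst.sub (contDiff_fst.comp contDiff_snd)).prodMk
    (contDiff_snd.comp contDiff_snd))

/-- The mean of `f` around `z`, weighted with the mollifier on the scale `e ^ s`. -/
noncomputable def mollification (f : ℂ → ℝ) (s : ℝ) (z : ℂ) : ℝ := ∫ ζ, f ζ * bump (z - ζ, s)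

theorem exp_const_le (s : ℝ) : ∀ ζ : ℂ, Real.exp s ≤ Real.exp s + ‖ζ‖ / 2 := fun ζ => by
  have := norm_nonneg ζ
  linarith

theorem locallyCompactlySupported_bump (ν : Measure ℂ) {s : ℂ → ℝ} {A : ℝ}
    (hs : ∀ ζ, Real.exp (s ζ) ≤ A + ‖ζ‖ / 2) :
    LocallyCompactlySupported ν (fun ζ => (ζ, s ζ))
      (fun q : ℂ × (ℂ × ℝ) => bump (q.1 - q.2.1, q.2.2)) :=
  locallyCompactlySupported_translate (fun _ _ h _ => bump_eq_zero h) ν hs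

theorem locallyCompactlySupported_potential (ν : Measure ℂ) {s : ℂ → ℝ} {A : ℝ}
    (hs : ∀ ζ, Real.exp (s ζ) ≤ A + ‖ζ‖ / 2) :
    LocallyCompactlySupported ν (fun ζ => (ζ, s ζ))
      (fun q : ℂ × (ℂ × ℝ) => potential (q.1 - q.2.1, q.2.2)) :=
  locallyCompactlySupported_translate (fun _ _ h h' => potential_eq_zero h h') ν hs

theorem integrable_mul_bump {ν : Measure ℂ} {g : ℂ → ℝ} (hg : LocallyIntegrable g ν) {s : ℂ → ℝ}
    (hsc : Continuous s) {A : ℝ} (hs : ∀ ζ, Real.exp (s ζ) ≤ A + ‖ζ‖ / 2) (z : ℂ) :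
    Integrable (fun ζ => g ζ * bump (z - ζ, s ζ)) ν :=
  (locallyCompactlySupported_bump ν hs).integrable hg (continuous_id.prodMk hsc)
    (contDiff_translate contDiff_bump).continuous z

theorem integrable_potential {ν : Measure ℂ} [IsLocallyFiniteMeasure ν] {s : ℂ → ℝ}
    (hsc : Continuous s) {A : ℝ} (hs : ∀ ζ, Real.exp (s ζ) ≤ A + ‖ζ‖ / 2) (z : ℂ) :
    Integrable (fun ζ => potential (z - ζ, s ζ)) ν := by
  simpa using (locallyCompactlySupported_potential ν hs).integrable (g := fun _ => 1)
    (locallyIntegrable_const _) (continuous_id.prodMk hsc)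
    (contDiff_translate contDiff_potential).continuous z

/-- Being radial, `bump (z - w, s)` has the same Laplacian in `z` as in `w`. -/
theorem laplacian_bump (s : ℝ) (z w : ℂ) :
    (Δ (fun z => bump (z - w, s))) z = (Δ (fun w => bump (w - z, s))) w := by
  have hd (a : ℝ) : HasDerivAt profile (deriv profile a) a :=
    (contDiff_profile.differentiable (by simp)).differentiableAt.hasDerivAt
  have hdd (a : ℝ) : HasDerivAt (deriv profile) (deriv (deriv profile) a) a :=
    ((contDiff_infty_iff_deriv.1 contDiff_profile).2.differentiable
      (by simp)).differentiableAt.hasDerivAt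
  have h (u v : ℂ) := laplacian_radial
    (fun a => ((hd a).const_mul (Real.exp (-2 * s))).const_mul profileMass⁻¹)
    (fun a => ((hdd a).const_mul (Real.exp (-2 * s))).const_mul profileMass⁻¹)
    (Real.exp (-2 * s)) u v
  simp only [bump]
  rw [h, h, norm_sub_rev]

variable {φ : ℂ → EReal} {μ : Measure ℂ}

/-- The dependence of the weighted means on the scale, from the distributional Laplacian tested
with the potential. -/
theorem IsDistribLaplacian.mollification_sub (hμ : IsDistribLaplacian φ μ) (s : ℝ) (z : ℂ) :
    mollification (fun z => (φ z).toReal) s z - mollification (fun z => (φ z).toReal) 0 z =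
      ∫ ζ, potential (z - ζ, s) ∂μ := by
  have h := hμ.integral_eq (fun ζ => potential (ζ - z, s))
    (contDiff_potential.comp ((contDiff_id.sub contDiff_const).prodMk contDiff_const))
    (HasCompactSupport.intro (isCompact_closedBall z (max 1 (Real.exp s))) fun ζ hζ => by
      have h1 : max 1 (Real.exp s) < ‖ζ - z‖ := by simpa [dist_eq_norm] using hζ
      exact potential_eq_zero ((le_max_right _ _).trans h1.le) ((le_max_left _ _).trans h1.le))
  simp_rw [laplacian_potential, mul_sub] at h
  rw [integral_sub] at h
  · simpa only [mollification, bump_sub_comm z, potential_sub_comm z] using h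
  · simpa only [bump_sub_comm z] using
      integrable_mul_bump hμ.locallyIntegrable continuous_const (exp_const_le s) z
  · simpa only [bump_sub_comm z] using
      integrable_mul_bump hμ.locallyIntegrable continuous_const (exp_const_le 0) z

theorem IsDistribLaplacian.laplacian_mollification (hμ : IsDistribLaplacian φ μ) (s : ℝ) (z : ℂ) :
    (Δ (mollification (fun z => (φ z).toReal) s)) z = ∫ ζ, bump (z - ζ, s) ∂μ := by
  have h := hμ.integral_eq (fun ζ => bump (ζ - z, s))
    (contDiff_bump.comp ((contDiff_id.sub contDiff_const).prodMk contDiff_const))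
    (HasCompactSupport.intro (isCompact_closedBall z (Real.exp s)) fun ζ hζ => by
      have h1 : Real.exp s < ‖ζ - z‖ := by simpa [dist_eq_norm] using hζ
      exact bump_eq_zero h1.le)
  have h2 := laplacian_integral_param hμ.locallyIntegrable
    (j := fun ζ : ℂ => (ζ, s)) (continuous_id.prodMk continuous_const)
    (contDiff_translate contDiff_bump)
    (locallyCompactlySupported_bump volume (exp_const_le s)) z
  simp only at h2
  unfold mollification
  rw [h2]
  simp_rw [laplacian_bump s z, h, bump_sub_comm]

/-- The increase of the weighted means of `φ` with the logarithmic scale is controlled by the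
mass. -/
theorem IsDistribLaplacian.mollification_sub_mollification_le (hμ : IsDistribLaplacian φ μ) (z : ℂ)
    {s s' : ℝ} (h : s' ≤ s) :
    mollification (fun z => (φ z).toReal) s z - mollification (fun z => (φ z).toReal) s' z ≤
      (2 * profileMass)⁻¹ * (s - s') * μ.real (ball z (Real.exp s)) := by
  have := hμ.locallyFinite
  rw [← sub_sub_sub_cancel_right _ _ (mollification (fun z => (φ z).toReal) 0 z),
    hμ.mollification_sub, hμ.mollification_sub,
    ← integral_sub (integrable_potential continuous_const (exp_const_le s) z)
      (integrable_potential continuous_const (exp_const_le s') z),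
    ← setIntegral_eq_integral_of_forall_compl_eq_zero (s := ball z (Real.exp s)),
    mul_comm _ (μ.real _), ← smul_eq_mul, ← setIntegral_const]
  · refine setIntegral_mono_on ?_ ?_ measurableSet_ball fun ζ _ => (potential_sub_mem h).2
    · exact ((integrable_potential continuous_const (exp_const_le s) z).sub
        (integrable_potential continuous_const (exp_const_le s') z)).integrableOn
    · exact integrableOn_const measure_ball_lt_top.ne
  · intro ζ hζ
    have h1 : Real.exp s ≤ ‖z - ζ‖ := by simpa [dist_eq_norm, norm_sub_rev] using hζ
    rw [potential_eq_of_le h1 ((Real.exp_le_exp.2 h).trans h1), sub_self]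

end Mollification

/-! ### The sub-mean value property for weighted means -/

section SubMeanValue

/-- The parametrizations of a circle by `(-π, π)` and by `(0, 2π]` give the same integrals. -/
theorem setLIntegral_circleMap_eq (G : ℂ → ℝ≥0∞) (c : ℂ) (r : ℝ) :
    ∫⁻ θ in Ioo (-Real.pi) Real.pi, G (circleMap c r θ) =
      ∫⁻ θ in Ioc 0 (2 * Real.pi), G (circleMap c r θ) := by
  have h (t : ℝ) := isAddFundamentalDomain_Ioc Real.two_pi_pos t volume
  have h1 := (h 0).setLIntegral_eq (h (-Real.pi)) (fun θ => G (circleMap c r θ)) (by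
    rintro ⟨g, hg⟩ θ
    obtain ⟨n, rfl⟩ := AddSubgroup.mem_zmultiples_iff.1 hg
    have := (periodic_circleMap c r).zsmul n θ
    simp only [AddSubgroup.vadd_def, vadd_eq_add]
    rw [add_comm, this])
  rw [zero_add, show -Real.pi + 2 * Real.pi = Real.pi by ring] at h1
  rw [h1]
  exact setLIntegral_congr Ioo_ae_eq_Ioc

/-- Integration in polar coordinates around `c` against a radial weight. -/
theorem lintegral_radial_mul {k : ℝ → ℝ≥0∞} (hk : Measurable k) {G : ℂ → ℝ≥0∞}
    (hG : Measurable G) (c : ℂ) :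
    ∫⁻ w, k ‖w‖ * G (c + w) = ∫⁻ r in Ioi (0 : ℝ), ENNReal.ofReal r * k r *
      ∫⁻ θ in Ioc 0 (2 * Real.pi), G (circleMap c r θ) := by
  have hm : Measurable fun p : ℝ × ℝ => circleMap c p.1 p.2 := by
    unfold circleMap
    fun_prop
  rw [← Complex.lintegral_comp_polarCoord_symm, polarCoord_target, Measure.volume_eq_prod,
    ← Measure.prod_restrict]
  have h : ∀ᵐ p ∂((volume.restrict (Ioi (0 : ℝ))).prod
      (volume.restrict (Ioo (-Real.pi) Real.pi))),
      ENNReal.ofReal p.1 • (k ‖Complex.polarCoord.symm p‖ * G (c + Complex.polarCoord.symm p)) =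
      ENNReal.ofReal p.1 * k p.1 * G (circleMap c p.1 p.2) := by
    have h0 : ∀ᵐ p ∂((volume.restrict (Ioi (0 : ℝ))).prod
        (volume.restrict (Ioo (-Real.pi) Real.pi))), p ∈ Ioi (0 : ℝ) ×ˢ Ioo (-Real.pi) Real.pi := by
      rw [Measure.prod_restrict]
      exact ae_restrict_mem (measurableSet_Ioi.prod measurableSet_Ioo)
    filter_upwards [h0] with p hp
    have hp0 : 0 < p.1 := hp.1
    rw [Complex.norm_polarCoord_symm, abs_of_pos hp0, Complex.polarCoord_symm_apply, smul_eq_mul,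
      mul_assoc, circleMap, Complex.exp_mul_I, Complex.ofReal_cos, Complex.ofReal_sin]
  rw [lintegral_congr_ae h, lintegral_prod _ (by fun_prop)]
  refine lintegral_congr fun r => ?_
  simp only
  rw [lintegral_const_mul _ (by unfold circleMap; fun_prop), setLIntegral_circleMap_eq]

variable {φ : ℂ → EReal}

theorem Subharmonic.measurable (hφ : Subharmonic φ) : Measurable φ := hφ.usc.measurable

/-- The sub-mean value inequality, rearranged so that it makes sense in `[0, ∞]`. -/
theorem Subharmonic.lintegral_circle_le (hφ : Subharmonic φ) {c : ℂ} (hc : φ c ≠ ⊥) {r : ℝ}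
    (hr : 0 < r) :
    ∫⁻ θ in Ioc 0 (2 * Real.pi), ((-φ (circleMap c r θ)).toENNReal + (φ c).toENNReal) ≤
      ∫⁻ θ in Ioc 0 (2 * Real.pi), ((φ (circleMap c r θ)).toENNReal + (-φ c).toENNReal) := by
  have h := hφ.le_circleMean c r hr
  rw [lintegral_add_right _ measurable_const, lintegral_add_right _ measurable_const,
    setLIntegral_const, setLIntegral_const, Real.volume_Ioc, sub_zero]
  unfold circleMean at h
  set P := ∫⁻ θ in Ioc 0 (2 * Real.pi), (φ (circleMap c r θ)).toENNReal
  set N := ∫⁻ θ in Ioc 0 (2 * Real.pi), (-φ (circleMap c r θ)).toENNReal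
  set t := ENNReal.ofReal (2 * Real.pi)
  have ht0 : t ≠ 0 := by simp [t, Real.pi_pos]
  have htt : t ≠ ⊤ := ENNReal.ofReal_ne_top
  rw [← ENNReal.div_mul_cancel ht0 htt (b := N), ← ENNReal.div_mul_cancel ht0 htt (b := P),
    ← add_mul, ← add_mul]
  refine mul_le_mul_left ?_ _
  generalize P / t = x at h ⊢
  generalize N / t = y at h ⊢
  lift φ c to ℝ using ⟨(hφ.lt_top c).ne, hc⟩ with a
  rcases eq_or_ne x ⊤ with rfl | hx
  · simp
  rcases eq_or_ne y ⊤ with rfl | hy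
  · rw [EReal.coe_ennreal_top, EReal.sub_top] at h
    simp at h
  lift x to ℝ≥0 using hx
  lift y to ℝ≥0 using hy
  have h1 : a ≤ x - y := by
    have : ((x : ℝ≥0∞) : EReal) - ((y : ℝ≥0∞) : EReal) = ((x - y : ℝ) : EReal) := by
      push_cast; rfl
    rw [this] at h
    exact_mod_cast h
  rw [← EReal.coe_neg, EReal.toENNReal_of_ne_top (EReal.coe_ne_top a),
    EReal.toENNReal_of_ne_top (EReal.coe_ne_top (-a)), EReal.toReal_coe, EReal.toReal_coe,
    ← ENNReal.ofReal_coe_nnreal, ← ENNReal.ofReal_coe_nnreal]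
  rcases le_total 0 a with h2 | h2
  · rw [ENNReal.ofReal_of_nonpos (by linarith : -a ≤ 0), add_zero,
      ← ENNReal.ofReal_add y.coe_nonneg h2]
    exact ENNReal.ofReal_le_ofReal (by linarith)
  · rw [ENNReal.ofReal_of_nonpos h2, add_zero, ← ENNReal.ofReal_add x.coe_nonneg (neg_nonneg.2 h2)]
    exact ENNReal.ofReal_le_ofReal (by linarith)

theorem bump_neg (w : ℂ) (s : ℝ) : bump (-w, s) = bump (w, s) := by
  simp [bump]

theorem bump_norm (w : ℂ) (s : ℝ) : bump ((‖w‖ : ℂ), s) = bump (w, s) := by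
  simp [bump]

theorem Subharmonic.lintegral_bump_le (hφ : Subharmonic φ) {c : ℂ} (hc : φ c ≠ ⊥) (s : ℝ) :
    ∫⁻ w, ENNReal.ofReal (bump (w, s)) * ((-φ (c + w)).toENNReal + (φ c).toENNReal) ≤
      ∫⁻ w, ENNReal.ofReal (bump (w, s)) * ((φ (c + w)).toENNReal + (-φ c).toENNReal) := by
  have hk : Measurable fun r : ℝ => ENNReal.ofReal (bump ((r : ℂ), s)) :=
    (contDiff_bump.continuous.measurable.comp (by fun_prop)).ennreal_ofReal
  have hneg : Measurable fun z => (-φ z).toENNReal :=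
    (continuous_neg.measurable.comp hφ.measurable).ereal_toENNReal
  have h1 := lintegral_radial_mul hk (hneg.add_const (φ c).toENNReal) c
  have h2 := lintegral_radial_mul hk
    (hφ.measurable.ereal_toENNReal.add_const (-φ c).toENNReal) c
  simp only [bump_norm] at h1 h2
  rw [h1, h2]
  refine setLIntegral_mono' measurableSet_Ioi fun r hr => ?_
  gcongr _ * ?_
  exact hφ.lintegral_circle_le hc hr

variable {μ : Measure ℂ}

theorem integrable_bump_mul_translate {f : ℂ → ℝ} (hf : LocallyIntegrable f volume) (c : ℂ)
    (s : ℝ) : Integrable (fun w => f (c + w) * bump (w, s)) := by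
  have h := (integrable_mul_bump hf continuous_const (exp_const_le s) c).comp_add_left c
  simpa [bump_neg] using h

theorem mollification_eq_translate (f : ℂ → ℝ) (c : ℂ) (s : ℝ) :
    mollification f s c = ∫ w, f (c + w) * bump (w, s) := by
  rw [mollification, ← integral_add_left_eq_self _ c]
  simp [bump_neg]

theorem lintegral_ofReal_bump (s : ℝ) : ∫⁻ w, ENNReal.ofReal (bump (w, s)) = 1 := by
  rw [← ofReal_integral_eq_lintegral_ofReal _ (Eventually.of_forall fun w => bump_nonneg _),
    integral_bump, ENNReal.ofReal_one]
  by_contra h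
  have := integral_bump s
  rw [integral_undef h] at this
  exact zero_ne_one this

theorem Subharmonic.lintegral_pos_lt_top (hφ : Subharmonic φ)
    (hf : LocallyIntegrable (fun z => (φ z).toReal) volume) (c : ℂ) (s : ℝ) :
    ∫⁻ w, ENNReal.ofReal (bump (w, s)) * (φ (c + w)).toENNReal < ⊤ := by
  have h := (integrable_bump_mul_translate hf c s).lintegral_lt_top
  refine h.trans_le' (lintegral_mono fun w => ?_)
  rw [ENNReal.ofReal_mul' (bump_nonneg _), mul_comm, EReal.toENNReal_of_ne_top (hφ.lt_top _).ne]

/-- The sub-mean value inequality for weighted means, as an inequality in `[0, ∞]` between the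
integrals of the negative and of the positive part. -/
theorem Subharmonic.lintegral_bump_add_le (hφ : Subharmonic φ) {c : ℂ} (hc : φ c ≠ ⊥) (s : ℝ) :
    (∫⁻ w, ENNReal.ofReal (bump (w, s)) * (-φ (c + w)).toENNReal) + (φ c).toENNReal ≤
      (∫⁻ w, ENNReal.ofReal (bump (w, s)) * (φ (c + w)).toENNReal) + (-φ c).toENNReal := by
  have hb : Measurable fun w : ℂ => ENNReal.ofReal (bump (w, s)) :=
    (contDiff_bump.continuous.measurable.comp (by fun_prop)).ennreal_ofReal
  have h := hφ.lintegral_bump_le hc s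
  simp_rw [mul_add] at h
  rwa [lintegral_add_right _ (hb.mul_const _), lintegral_add_right _ (hb.mul_const _),
    lintegral_mul_const _ hb, lintegral_mul_const _ hb, lintegral_ofReal_bump, one_mul,
    one_mul] at h

/-- A subharmonic function is `-∞` on a null set only. -/
theorem Subharmonic.ae_ne_bot (hφ : Subharmonic φ)
    (hf : LocallyIntegrable (fun z => (φ z).toReal) volume) : ∀ᵐ z, φ z ≠ ⊥ := by
  obtain ⟨c, hc⟩ := hφ.not_bot
  -- the negative part has finite weighted means around `c`, on every scale
  have hfin (n : ℕ) : ∫⁻ w, ENNReal.ofReal (bump (w, n)) * (-φ (c + w)).toENNReal ≠ ⊤ := by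
    refine ((le_self_add.trans (hφ.lintegral_bump_add_le hc n)).trans_lt ?_).ne
    refine ENNReal.add_lt_top.2 ⟨hφ.lintegral_pos_lt_top hf c n, ?_⟩
    exact lt_top_iff_ne_top.2 (EReal.toENNReal_ne_top_iff.2 (by simpa using hc))
  have hneg : Measurable fun z => (-φ (c + z)).toENNReal :=
    (continuous_neg.measurable.comp (hφ.measurable.comp (by fun_prop))).ereal_toENNReal
  have hb (s : ℝ) : Measurable fun w : ℂ => ENNReal.ofReal (bump (w, s)) :=
    (contDiff_bump.continuous.measurable.comp (by fun_prop)).ennreal_ofReal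
  have h1 : ∀ᵐ w, ∀ n : ℕ, ENNReal.ofReal (bump (w, n)) * (-φ (c + w)).toENNReal < ⊤ :=
    ae_all_iff.2 fun n => ae_lt_top ((hb n).mul hneg) (hfin n)
  have h2 : ∀ᵐ w, φ (c + w) ≠ ⊥ := by
    filter_upwards [h1] with w hw hbot
    obtain ⟨n, hn⟩ := exists_nat_gt (2 * ‖w‖)
    have h3 : ‖w‖ < Real.exp n / 2 := by
      have := Real.add_one_le_exp (n : ℝ)
      linarith
    have h4 := hw n
    rw [hbot, EReal.neg_bot, EReal.toENNReal_top, ENNReal.mul_top] at h4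
    · exact lt_irrefl _ h4
    · rw [bump_eq_of_norm_lt h3]
      simp only [ne_eq, ENNReal.ofReal_eq_zero, not_le]
      exact mul_pos (inv_pos.2 profileMass_pos) (Real.exp_pos _)
  have h5 := (measurePreserving_add_left volume (-c)).quasiMeasurePreserving.ae h2
  simpa using h5

/-- A subharmonic function lies below its weighted means. -/
theorem Subharmonic.le_mollification (hφ : Subharmonic φ)
    (hf : LocallyIntegrable (fun z => (φ z).toReal) volume) (c : ℂ) (s : ℝ) :
    φ c ≤ (mollification (fun z => (φ z).toReal) s c : ℝ) := by
  rcases eq_or_ne (φ c) ⊥ with hc | hc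
  · simp [hc]
  have h := hφ.lintegral_bump_add_le hc s
  have hP := hφ.lintegral_pos_lt_top hf c s
  have hint := integrable_bump_mul_translate hf c s
  rw [mollification_eq_translate, integral_eq_lintegral_pos_part_sub_lintegral_neg_part hint]
  have hpos : ∫⁻ w, ENNReal.ofReal ((φ (c + w)).toReal * bump (w, s)) =
      ∫⁻ w, ENNReal.ofReal (bump (w, s)) * (φ (c + w)).toENNReal := by
    refine lintegral_congr fun w => ?_
    rw [ENNReal.ofReal_mul' (bump_nonneg _), mul_comm,
      EReal.toENNReal_of_ne_top (hφ.lt_top _).ne]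
  have hneg : ∫⁻ w, ENNReal.ofReal (-((φ (c + w)).toReal * bump (w, s))) ≤
      ∫⁻ w, ENNReal.ofReal (bump (w, s)) * (-φ (c + w)).toENNReal := by
    refine lintegral_mono fun w => ?_
    rw [← neg_mul, ENNReal.ofReal_mul' (bump_nonneg _), mul_comm]
    gcongr
    rcases eq_or_ne (φ (c + w)) ⊥ with hw | hw
    · simp [hw]
    · rw [EReal.toENNReal_of_ne_top (by simpa using hw), EReal.toReal_neg_eq]
  rw [hpos]
  set A := ∫⁻ w, ENNReal.ofReal (bump (w, s)) * (φ (c + w)).toENNReal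
  set B := ∫⁻ w, ENNReal.ofReal (-((φ (c + w)).toReal * bump (w, s)))
  have h1 : B + (φ c).toENNReal ≤ A + (-φ c).toENNReal :=
    (add_le_add_left hneg _).trans h
  lift φ c to ℝ using ⟨(hφ.lt_top c).ne, hc⟩ with a
  rw [← EReal.coe_neg, EReal.toENNReal_of_ne_top (EReal.coe_ne_top a),
    EReal.toENNReal_of_ne_top (EReal.coe_ne_top (-a)), EReal.toReal_coe, EReal.toReal_coe] at h1
  have hB : B ≠ ⊤ := ne_top_of_le_ne_top
    (ENNReal.add_lt_top.2 ⟨hP, ENNReal.ofReal_lt_top⟩).ne (le_self_add.trans h1)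
  have h2 := ENNReal.toReal_mono (ENNReal.add_ne_top.2 ⟨hP.ne, ENNReal.ofReal_ne_top⟩) h1
  rw [ENNReal.toReal_add hB ENNReal.ofReal_ne_top, ENNReal.toReal_add hP.ne ENNReal.ofReal_ne_top,
    ENNReal.toReal_ofReal', ENNReal.toReal_ofReal'] at h2
  refine EReal.coe_le_coe_iff.2 ?_
  rcases le_total 0 a with h3 | h3
  · rw [max_eq_left h3, max_eq_right (by linarith)] at h2
    linarith
  · rw [max_eq_right h3, max_eq_left (by linarith)] at h2
    linarith

/-- By upper semicontinuity, the weighted means on small scales are not much larger than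
the value at the centre. -/
theorem Subharmonic.eventually_mollification_le (hφ : Subharmonic φ)
    (hf : LocallyIntegrable (fun z => (φ z).toReal) volume) {c : ℂ} {a : ℝ} (ha : φ c < a) :
    ∀ᶠ s in atBot, mollification (fun z => (φ z).toReal) s c ≤ a := by
  obtain ⟨δ, hδ, hball⟩ := Metric.eventually_nhds_iff_ball.1 (hφ.usc c _ ha)
  filter_upwards [Real.tendsto_exp_atBot.eventually_lt_const hδ] with s hs
  have hi := integrable_mul_bump hf continuous_const (exp_const_le s) c
  have hb := integrable_mul_bump (locallyIntegrable_const (μ := volume) (1 : ℝ)) continuous_const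
    (exp_const_le s) c
  have h1 : ∫ ζ, bump (c - ζ, s) = 1 := by
    simp_rw [bump_sub_comm c]
    rw [integral_sub_right_eq_self (fun w => bump (w, s)), integral_bump]
  calc mollification (fun z => (φ z).toReal) s c ≤ ∫ ζ, a * bump (c - ζ, s) := by
        refine integral_mono_ae hi (by simpa using hb.const_mul a) ?_
        filter_upwards [hφ.ae_ne_bot hf] with ζ hζ
        by_cases h2 : ζ ∈ ball c δ
        · refine mul_le_mul_of_nonneg_right ?_ (bump_nonneg _)
          have := (hball ζ h2).le
          rwa [← EReal.coe_toReal (hφ.lt_top ζ).ne hζ, EReal.coe_le_coe_iff] at this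
        · have h3 : Real.exp s ≤ ‖c - ζ‖ := by
            have : δ ≤ ‖ζ - c‖ := by simpa [dist_eq_norm] using h2
            rw [norm_sub_rev]
            linarith
          simp [bump_eq_zero h3]
    _ = a := by rw [integral_const_mul, h1, mul_one]

end SubMeanValue

/-! ### Upper bound for weighted means -/

section MollificationUpper

variable {φ : ℂ → EReal} {μ : Measure ℂ}

/-- Shrinking the scale `n` times by the factor `3` costs a geometric sum of masses. -/
theorem mollification_sub_pow_le (hμ : IsDistribLaplacian φ μ) {γ : ℝ} (hγ0 : 0 ≤ γ) (hγ1 : γ < 1)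
    (hγ : ∀ (z : ℂ) (r : ℝ), 0 < r → μ.real (ball z r) ≤ γ * μ.real (ball z (3 * r)))
    (z : ℂ) (s : ℝ) (n : ℕ) :
    mollification (fun z => (φ z).toReal) s z -
        mollification (fun z => (φ z).toReal) (s - n * Real.log 3) z ≤
      (2 * profileMass)⁻¹ * Real.log 3 / (1 - γ) * μ.real (ball z (Real.exp s)) := by
  set M := fun k : ℕ => mollification (fun z => (φ z).toReal) (s - k * Real.log 3) z with hM
  have hl : 0 < Real.log 3 := Real.log_pos (by norm_num)
  have hstep (k : ℕ) : M k - M (k + 1) ≤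
      (2 * profileMass)⁻¹ * Real.log 3 * μ.real (ball z (Real.exp s)) * γ ^ k := by
    have h1 := hμ.mollification_sub_mollification_le z
      (show s - (k + 1 : ℕ) * Real.log 3 ≤ s - k * Real.log 3 by push_cast; linarith)
    have h2 := measure_ball_le_pow hγ0 hγ z (Real.exp_pos (s - k * Real.log 3)) k
    have h3 : 3 ^ k * Real.exp (s - k * Real.log 3) = Real.exp s := by
      rw [Real.exp_sub, Real.exp_nat_mul, Real.exp_log (by norm_num)]
      field_simp
    rw [h3] at h2
    refine h1.trans ?_
    rw [show s - k * Real.log 3 - (s - (k + 1 : ℕ) * Real.log 3) = Real.log 3 by push_cast; ring,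
      mul_assoc _ _ (γ ^ k), mul_comm _ (γ ^ k)]
    have := profileMass_pos
    gcongr
  have hsum := Finset.sum_le_sum fun k (_ : k ∈ Finset.range n) => hstep k
  rw [Finset.sum_range_sub', ← Finset.mul_sum] at hsum
  have hgeom : ∑ k ∈ Finset.range n, γ ^ k ≤ (1 - γ)⁻¹ := by
    rw [← tsum_geometric_of_lt_one hγ0 hγ1]
    exact (summable_geometric_of_lt_one hγ0 hγ1).sum_le_tsum _ fun k _ => pow_nonneg hγ0 k
  have h0 : mollification (fun z => (φ z).toReal) s z = M 0 := by simp [hM]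
  rw [h0]
  refine hsum.trans ?_
  have := profileMass_pos
  calc _ ≤ (2 * profileMass)⁻¹ * Real.log 3 * μ.real (ball z (Real.exp s)) * (1 - γ)⁻¹ := by
        gcongr
    _ = _ := by ring

/-- Weighted means exceed the value at the centre by at most a multiple of the mass: the masses of
concentric discs decay geometrically. -/
theorem Subharmonic.mollification_sub_le (hφ : Subharmonic φ) (hμ : IsDistribLaplacian φ μ)
    {γ : ℝ} (hγ0 : 0 ≤ γ) (hγ1 : γ < 1)
    (hγ : ∀ (z : ℂ) (r : ℝ), 0 < r → μ.real (ball z r) ≤ γ * μ.real (ball z (3 * r)))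
    (z : ℂ) (s : ℝ) :
    ((mollification (fun z => (φ z).toReal) s z - (2 * profileMass)⁻¹ * Real.log 3 / (1 - γ) *
      μ.real (ball z (Real.exp s)) : ℝ) : EReal) ≤ φ z := by
  refine EReal.le_of_forall_lt_iff_le.1 fun a ha => ?_
  have hl : 0 < Real.log 3 := Real.log_pos (by norm_num)
  have ht : Tendsto (fun n : ℕ => s - n * Real.log 3) atTop atBot :=
    tendsto_atBot_add_const_left _ s
      (tendsto_neg_atTop_atBot.comp (tendsto_natCast_atTop_atTop.atTop_mul_const hl))
  obtain ⟨n, hn⟩ := (ht.eventually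
    (hφ.eventually_mollification_le hμ.locallyIntegrable ha)).exists
  have h := mollification_sub_pow_le hμ hγ0 hγ1 hγ z s n
  exact EReal.coe_le_coe_iff.2 (by linarith)

end MollificationUpper

/-! ### Smooth functions with nonnegative Laplacian -/

section SmoothSubharmonic

theorem hasDerivAt_circle_integral {Φ : ℝ × ℝ → ℝ} (hΦ : ContDiff ℝ ∞ Φ) {Φ' : ℝ → ℝ → ℝ}
    (h : ∀ r θ, HasDerivAt (fun r => Φ (r, θ)) (Φ' r θ) r) (r : ℝ) :
    HasDerivAt (fun r => ∫ θ in Ioc 0 (2 * Real.pi), Φ (r, θ))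
      (∫ θ in Ioc 0 (2 * Real.pi), Φ' r θ) r := by
  have hs : LocallyCompactlySupported (volume.restrict (Ioc 0 (2 * Real.pi)))
      (fun θ : ℝ => θ) Φ := fun r₀ => by
    refine ⟨Icc 0 (2 * Real.pi), isCompact_Icc, univ, isOpen_univ, mem_univ _, ?_⟩
    filter_upwards [ae_restrict_mem measurableSet_Ioc] with θ hθ hθ'
    exact absurd (Ioc_subset_Icc_self hθ) hθ'
  have hone : LocallyIntegrable (fun _ : ℝ => (1 : ℝ)) (volume.restrict (Ioc 0 (2 * Real.pi))) :=
    locallyIntegrable_const _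
  have h1 := (hasFDerivAt_integral_param hone continuous_id hΦ hs r).hasDerivAt
  have h2 := (hs.partialFDeriv hΦ).integrable hone continuous_id hΦ.partialFDeriv.continuous r
  simp only [id, smul_eq_mul, one_mul, one_smul] at h1 h2
  rw [ContinuousLinearMap.integral_apply h2] at h1
  have h3 (θ : ℝ) : partialFDeriv Φ (r, θ) 1 = Φ' r θ :=
    (hasFDerivAt_partial hΦ r θ).hasDerivAt.unique (h r θ)
  simp_rw [h3] at h1
  exact h1

variable {ψ : ℂ → ℝ}

/-- The sub-mean value property: with `A` the circle mean as a function of the radius,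
`r (r A')' = ∫ r² Δψ dθ ≥ 0` by the polar form of the Laplacian, so that `r A'` and then `A`
are nondecreasing. -/
theorem ContDiff.le_circle_integral (hψ : ContDiff ℝ ∞ ψ) (hΔ : ∀ z, 0 ≤ (Δ ψ) z) (c : ℂ)
    {r : ℝ} (hr : 0 ≤ r) :
    2 * Real.pi * ψ c ≤ ∫ θ in Ioc 0 (2 * Real.pi), ψ (circleMap c r θ) := by
  set e : ℝ → ℂ := fun θ => Complex.exp (θ * Complex.I) with he
  have hcirc (r θ : ℝ) : circleMap c r θ = c + r * e θ := rfl
  have heS : ContDiff ℝ ∞ e :=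
    Complex.contDiff_exp.comp ((Complex.ofRealCLM.contDiff).mul contDiff_const)
  have hcS : ContDiff ℝ ∞ (fun p : ℝ × ℝ => circleMap c p.1 p.2) :=
    contDiff_const.add ((Complex.ofRealCLM.contDiff.comp contDiff_fst).mul
      (heS.comp contDiff_snd))
  have hDψ : ContDiff ℝ ∞ (fderiv ℝ ψ) := hψ.fderiv_right (m := ∞) (by simp)
  have hd (z : ℂ) : HasFDerivAt ψ (fderiv ℝ ψ z) z :=
    (hψ.differentiable (by simp)).differentiableAt.hasFDerivAt
  have hdd (z : ℂ) : HasFDerivAt (fderiv ℝ ψ) (fderiv ℝ (fderiv ℝ ψ) z) z :=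
    (hDψ.differentiable (by simp)).differentiableAt.hasFDerivAt
  have hcr (r θ : ℝ) : HasDerivAt (fun r : ℝ => circleMap c r θ) (e θ) r := by
    have h := ((Complex.ofRealCLM.hasDerivAt (x := r)).mul_const (e θ)).const_add c
    rw [Complex.ofRealCLM_apply, Complex.ofReal_one, one_mul] at h
    exact h
  have hcθ (r θ : ℝ) : HasDerivAt (fun θ : ℝ => circleMap c r θ) (r * (e θ * Complex.I)) θ := by
    have h := hasDerivAt_circleMap c r θ
    rwa [circleMap_zero, mul_assoc] at h
  have heθ (θ : ℝ) : HasDerivAt e (e θ * Complex.I) θ := by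
    have h := hasDerivAt_circleMap 0 1 θ
    have h1 : circleMap 0 1 = e := by
      funext θ
      simp [circleMap, he]
    rwa [h1] at h
  -- radial derivatives of the circle integral
  have hA (r : ℝ) := hasDerivAt_circle_integral (hψ.comp hcS)
    (fun r θ => (hd _).comp_hasDerivAt r (hcr r θ)) r
  have hA' (r : ℝ) := hasDerivAt_circle_integral
    (Φ := fun p => fderiv ℝ ψ (circleMap c p.1 p.2) (e p.2))
    ((hDψ.comp hcS).clm_apply (heS.comp contDiff_snd))
    (fun r θ => by
      simpa using ((hdd _).comp_hasDerivAt r (hcr r θ)).clm_apply (hasDerivAt_const r (e θ))) r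
  -- the angular part of the Laplacian integrates to zero
  have hθ (r : ℝ) : ∫ θ in Ioc 0 (2 * Real.pi),
      (r ^ 2 * fderiv ℝ (fderiv ℝ ψ) (circleMap c r θ) (e θ * Complex.I) (e θ * Complex.I) -
        r * fderiv ℝ ψ (circleMap c r θ) (e θ)) = 0 := by
    have hder (θ : ℝ) : HasDerivAt
        (fun θ => r * fderiv ℝ ψ (circleMap c r θ) (e θ * Complex.I))
        (r ^ 2 * fderiv ℝ (fderiv ℝ ψ) (circleMap c r θ) (e θ * Complex.I) (e θ * Complex.I) -
        r * fderiv ℝ ψ (circleMap c r θ) (e θ)) θ := by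
      have h := (((hdd _).comp_hasDerivAt θ (hcθ r θ)).clm_apply
        ((heθ θ).mul_const Complex.I)).const_mul r
      convert! h using 1
      have h1 : (r : ℂ) * (e θ * Complex.I) = r • (e θ * Complex.I) := by simp
      have h2 : e θ * Complex.I * Complex.I = -e θ := by
        rw [mul_assoc, Complex.I_mul_I]; ring
      rw [h1, h2, map_smul, map_neg]
      simp
      ring
    have hcont : Continuous fun θ =>
        (r ^ 2 * fderiv ℝ (fderiv ℝ ψ) (circleMap c r θ) (e θ * Complex.I) (e θ * Complex.I) -
        r * fderiv ℝ ψ (circleMap c r θ) (e θ)) := by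
      have h1 := heS.continuous
      have h2 := hDψ.continuous
      have h3 := (hDψ.fderiv_right (m := ∞) (by simp)).continuous
      have h4 := continuous_circleMap c r
      have h5 : Continuous fun θ => fderiv ℝ (fderiv ℝ ψ) (circleMap c r θ) := h3.comp h4
      have h6 : Continuous fun θ => fderiv ℝ ψ (circleMap c r θ) := h2.comp h4
      fun_prop
    rw [← intervalIntegral.integral_of_le Real.two_pi_pos.le,
      intervalIntegral.integral_eq_sub_of_hasDerivAt (fun θ _ => hder θ)
        (hcont.intervalIntegrable _ _)]
    have h1 : e (2 * Real.pi) = e 0 := by simp [he]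
    have h2 : circleMap c r (2 * Real.pi) = circleMap c r 0 := by
      rw [hcirc, hcirc, h1]
    rw [h1, h2, sub_self]
  set A := fun r : ℝ => ∫ θ in Ioc 0 (2 * Real.pi), ψ (circleMap c r θ)
  set A1 := fun r : ℝ => ∫ θ in Ioc 0 (2 * Real.pi), fderiv ℝ ψ (circleMap c r θ) (e θ)
  set A2 := fun r : ℝ => ∫ θ in Ioc 0 (2 * Real.pi),
    fderiv ℝ (fderiv ℝ ψ) (circleMap c r θ) (e θ) (e θ)
  have hA (r : ℝ) : HasDerivAt A (A1 r) r := hA r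
  have hA' (r : ℝ) : HasDerivAt A1 (A2 r) r := hA' r
  have hB (r : ℝ) : HasDerivAt (fun r => r * A1 r) (1 * A1 r + r * A2 r) r :=
    (hasDerivAt_id r).mul (hA' r)
  -- the Laplacian is the trace of the second derivative in the frame `e θ`, `i e θ`
  have hlap (r θ : ℝ) : r ^ 2 * fderiv ℝ (fderiv ℝ ψ) (circleMap c r θ) (e θ) (e θ) +
      r ^ 2 * fderiv ℝ (fderiv ℝ ψ) (circleMap c r θ) (e θ * Complex.I) (e θ * Complex.I) =
      r ^ 2 * (Δ ψ) (circleMap c r θ) := by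
    have h1 : e θ = Real.cos θ • (1 : ℂ) + Real.sin θ • Complex.I := by
      simp [he, Complex.exp_mul_I]
    have h2 : e θ * Complex.I = -Real.sin θ • (1 : ℂ) + Real.cos θ • Complex.I := by
      rw [h1]
      apply Complex.ext <;> simp
    rw [laplacian_eq_fderiv_fderiv, h2, h1]
    simp only [map_add, map_smul, _root_.add_apply, _root_.smul_apply,
      smul_eq_mul]
    linear_combination r ^ 2 * (fderiv ℝ (fderiv ℝ ψ) (circleMap c r θ) 1 1 +
      fderiv ℝ (fderiv ℝ ψ) (circleMap c r θ) Complex.I Complex.I) * Real.sin_sq_add_cos_sq θ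
  have hBnn (r : ℝ) (hr : 0 < r) : 0 ≤ 1 * A1 r + r * A2 r := by
    have h1 := heS.continuous
    have h4 := continuous_circleMap c r
    have h5 : Continuous fun θ => fderiv ℝ (fderiv ℝ ψ) (circleMap c r θ) :=
      (hDψ.fderiv_right (m := ∞) (by simp)).continuous.comp h4
    have h6 : Continuous fun θ => fderiv ℝ ψ (circleMap c r θ) := hDψ.continuous.comp h4
    have hi {f : ℝ → ℝ} (hf : Continuous f) : IntegrableOn f (Ioc 0 (2 * Real.pi)) :=
      (hf.integrableOn_Icc).mono_set Ioc_subset_Icc_self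
    have h7 : r * (1 * A1 r + r * A2 r) =
        ∫ θ in Ioc 0 (2 * Real.pi), r ^ 2 * (Δ ψ) (circleMap c r θ) := by
      have h8 : r * A1 r + r ^ 2 * A2 r + ∫ θ in Ioc 0 (2 * Real.pi),
          (r ^ 2 * fderiv ℝ (fderiv ℝ ψ) (circleMap c r θ) (e θ * Complex.I) (e θ * Complex.I) -
            r * fderiv ℝ ψ (circleMap c r θ) (e θ)) = r * (1 * A1 r + r * A2 r) := by
        rw [hθ r]
        ring
      have e1 : r * A1 r = ∫ θ in Ioc 0 (2 * Real.pi), r * fderiv ℝ ψ (circleMap c r θ) (e θ) :=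
        (integral_const_mul _ _).symm
      have e2 : r ^ 2 * A2 r = ∫ θ in Ioc 0 (2 * Real.pi),
          r ^ 2 * fderiv ℝ (fderiv ℝ ψ) (circleMap c r θ) (e θ) (e θ) :=
        (integral_const_mul _ _).symm
      have c1 : Continuous fun θ => r * fderiv ℝ ψ (circleMap c r θ) (e θ) := by fun_prop
      have c2 : Continuous fun θ =>
          r ^ 2 * fderiv ℝ (fderiv ℝ ψ) (circleMap c r θ) (e θ) (e θ) := by fun_prop
      have c3 : Continuous fun θ => r ^ 2 * fderiv ℝ (fderiv ℝ ψ) (circleMap c r θ)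
          (e θ * Complex.I) (e θ * Complex.I) - r * fderiv ℝ ψ (circleMap c r θ) (e θ) := by
        fun_prop
      have c4 : Continuous fun θ => r * fderiv ℝ ψ (circleMap c r θ) (e θ) +
          r ^ 2 * fderiv ℝ (fderiv ℝ ψ) (circleMap c r θ) (e θ) (e θ) := c1.add c2
      rw [← h8, e1, e2, ← integral_add (hi c1) (hi c2), ← integral_add (hi c4) (hi c3)]
      refine integral_congr_ae (Eventually.of_forall fun θ => ?_)
      simp only
      rw [← hlap]
      ring
    have h9 : 0 ≤ r * (1 * A1 r + r * A2 r) := by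
      rw [h7]
      exact integral_nonneg fun θ => mul_nonneg (sq_nonneg r) (hΔ _)
    exact nonneg_of_mul_nonneg_right h9 hr
  have hBmono : MonotoneOn (fun r => r * A1 r) (Ici 0) := by
    refine monotoneOn_of_deriv_nonneg (convex_Ici 0)
      (fun r _ => (hB r).continuousAt.continuousWithinAt)
      (fun r _ => (hB r).differentiableAt.differentiableWithinAt) fun r hr => ?_
    rw [interior_Ici] at hr
    rw [(hB r).deriv]
    exact hBnn r hr
  have hAmono : MonotoneOn A (Ici 0) := by
    refine monotoneOn_of_deriv_nonneg (convex_Ici 0)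
      (fun r _ => (hA r).continuousAt.continuousWithinAt)
      (fun r _ => (hA r).differentiableAt.differentiableWithinAt) fun r hr => ?_
    rw [interior_Ici] at hr
    rw [(hA r).deriv]
    have h1 := hBmono self_mem_Ici (mem_Ici.2 (le_of_lt hr)) (le_of_lt hr)
    simp only [zero_mul] at h1
    exact nonneg_of_mul_nonneg_right h1 hr
  have h := hAmono self_mem_Ici hr hr
  have h0 : A 0 = 2 * Real.pi * ψ c := by
    simp [A, Real.pi_pos.le]
  rwa [h0] at h

theorem ContDiff.subharmonic (hψ : ContDiff ℝ ∞ ψ) (hΔ : ∀ z, 0 ≤ (Δ ψ) z) :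
    Subharmonic (fun z => (ψ z : EReal)) := by
  refine ⟨fun z => EReal.coe_lt_top _, ⟨0, EReal.coe_ne_bot _⟩,
    (continuous_coe_real_ereal.comp hψ.continuous).upperSemicontinuous, fun c r hr => ?_⟩
  have h := hψ.le_circle_integral hΔ c hr.le
  have hint : Integrable (fun θ => ψ (circleMap c r θ))
      (volume.restrict (Ioc 0 (2 * Real.pi))) :=
    ((hψ.continuous.comp (continuous_circleMap c r)).integrableOn_Icc).mono_set
      Ioc_subset_Icc_self
  rw [integral_eq_lintegral_pos_part_sub_lintegral_neg_part hint] at h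
  have hP := hint.lintegral_lt_top
  have hN := hint.neg.lintegral_lt_top
  simp only [Pi.neg_apply] at hN
  unfold circleMean
  simp only [← EReal.coe_neg, EReal.toENNReal_of_ne_top (EReal.coe_ne_top _), EReal.toReal_coe]
  set P := ∫⁻ θ in Ioc 0 (2 * Real.pi), ENNReal.ofReal (ψ (circleMap c r θ))
  set N := ∫⁻ θ in Ioc 0 (2 * Real.pi), ENNReal.ofReal (-ψ (circleMap c r θ))
  have hπ : ENNReal.ofReal (2 * Real.pi) ≠ 0 := by simp [Real.pi_pos]
  have hc {x : ℝ≥0∞} (hx : x < ⊤) : ((x / ENNReal.ofReal (2 * Real.pi) : ℝ≥0∞) : EReal) =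
      ((x.toReal / (2 * Real.pi) : ℝ) : EReal) := by
    rw [← EReal.coe_toReal (x := ((x / ENNReal.ofReal (2 * Real.pi) : ℝ≥0∞) : EReal))
      (by simpa using (ENNReal.div_lt_top hx.ne hπ).ne) (by simp)]
    rw [EReal.toReal_coe_ennreal, ENNReal.toReal_div,
      ENNReal.toReal_ofReal Real.two_pi_pos.le]
  rw [hc hP, hc hN, ← EReal.coe_sub, EReal.coe_le_coe_iff, ← sub_div,
    le_div_iff₀ Real.two_pi_pos]
  linarith

end SmoothSubharmonic

/-! ### Green's identity -/

section Green

theorem integral_mul_fderiv_fderiv_comm {f η : ℂ → ℝ} (hf : ContDiff ℝ ∞ f) (hη : ContDiff ℝ ∞ η)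
    (hc : HasCompactSupport η) (v : ℂ) :
    ∫ z, f z * fderiv ℝ (fderiv ℝ η) z v v = ∫ z, fderiv ℝ (fderiv ℝ f) z v v * η z := by
  have hd {g : ℂ → ℝ} (hg : ContDiff ℝ ∞ g) : ContDiff ℝ ∞ fun z => fderiv ℝ g z v :=
    (hg.fderiv_right (m := ∞) (by simp)).clm_apply contDiff_const
  have hdd {g : ℂ → ℝ} (hg : ContDiff ℝ ∞ g) (z : ℂ) :
      fderiv ℝ (fun z => fderiv ℝ g z v) z v = fderiv ℝ (fderiv ℝ g) z v v := by
    have h1 : HasFDerivAt (fderiv ℝ g) (fderiv ℝ (fderiv ℝ g) z) z :=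
      ((hg.fderiv_right (m := ∞) (by simp)).differentiable (by simp)).differentiableAt.hasFDerivAt
    rw [(h1.clm_apply (hasFDerivAt_const v z)).fderiv]
    simp
  have hcd : HasCompactSupport fun z => fderiv ℝ η z v :=
    (hc.fderiv (𝕜 := ℝ)).comp_left (g := fun L : ℂ →L[ℝ] ℝ => L v) rfl
  have hcdd : HasCompactSupport fun z => fderiv ℝ (fderiv ℝ η) z v v :=
    ((hc.fderiv (𝕜 := ℝ)).fderiv (𝕜 := ℝ)).comp_left
      (g := fun L : ℂ →L[ℝ] ℂ →L[ℝ] ℝ => L v v) rfl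
  have hdiff {g : ℂ → ℝ} (hg : ContDiff ℝ ∞ g) (z : ℂ) : DifferentiableAt ℝ g z :=
    (hg.differentiable (by simp)).differentiableAt
  have hcont2 {g : ℂ → ℝ} (hg : ContDiff ℝ ∞ g) :
      Continuous fun z => fderiv ℝ (fderiv ℝ g) z v v := by
    simp_rw [← hdd hg]
    exact (hd (hd hg)).continuous
  have h1 : ∫ z, f z * fderiv ℝ (fun z => fderiv ℝ η z v) z v =
      -∫ z, fderiv ℝ f z v * fderiv ℝ η z v := by
    refine integral_mul_fderiv_eq_neg_fderiv_mul_of_integrable ?_ ?_ ?_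
      (fun z _ => hdiff hf z) (fun z _ => hdiff (hd hη) z)
    · exact ((hd hf).continuous.mul (hd hη).continuous).integrable_of_hasCompactSupport
        hcd.mul_left
    · simp_rw [hdd hη]
      exact (hf.continuous.mul (hcont2 hη)).integrable_of_hasCompactSupport hcdd.mul_left
    · exact (hf.continuous.mul (hd hη).continuous).integrable_of_hasCompactSupport hcd.mul_left
  have h2 : ∫ z, fderiv ℝ f z v * fderiv ℝ η z v =
      -∫ z, fderiv ℝ (fun z => fderiv ℝ f z v) z v * η z := by
    refine integral_mul_fderiv_eq_neg_fderiv_mul_of_integrable ?_ ?_ ?_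
      (fun z _ => hdiff (hd hf) z) (fun z _ => hdiff hη z)
    · simp_rw [hdd hf]
      exact ((hcont2 hf).mul hη.continuous).integrable_of_hasCompactSupport hc.mul_left
    · exact ((hd hf).continuous.mul (hd hη).continuous).integrable_of_hasCompactSupport
        hcd.mul_left
    · exact ((hd hf).continuous.mul hη.continuous).integrable_of_hasCompactSupport hc.mul_left
  rw [h2, neg_neg] at h1
  simpa only [hdd hf, hdd hη] using h1

/-- The measure with density `Δψ`, for smooth `ψ`. -/
noncomputable def laplacianMeasure (ψ : ℂ → ℝ) : Measure ℂ :=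
  volume.withDensity fun z => ENNReal.ofReal ((Δ ψ) z)

/-- A smooth function with nonnegative Laplacian has that Laplacian also in the sense of
distributions. -/
theorem ContDiff.isDistribLaplacian {ψ : ℂ → ℝ} (hψ : ContDiff ℝ ∞ ψ) (hΔ : ∀ z, 0 ≤ (Δ ψ) z) :
    IsDistribLaplacian (fun z => (ψ z : EReal)) (laplacianMeasure ψ) := by
  have hcont : Continuous (Δ ψ) := hψ.laplacian_infty.continuous
  refine ⟨?_, ?_, fun η hη hc => ?_⟩
  · exact IsLocallyFiniteMeasure.withDensity_ofReal hcont
  · simpa using hψ.continuous.locallyIntegrable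
  · have hc2 (v : ℂ) : HasCompactSupport fun z => fderiv ℝ (fderiv ℝ η) z v v :=
      ((hc.fderiv (𝕜 := ℝ)).fderiv (𝕜 := ℝ)).comp_left
        (g := fun L : ℂ →L[ℝ] ℂ →L[ℝ] ℝ => L v v) rfl
    have hcont2 {g : ℂ → ℝ} (hg : ContDiff ℝ ∞ g) (v : ℂ) :
        Continuous fun z => fderiv ℝ (fderiv ℝ g) z v v :=
      ((((hg.fderiv_right (m := ∞) (by simp)).fderiv_right (m := ∞) (by simp)).clm_apply
        contDiff_const).clm_apply contDiff_const).continuous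
    have hi1 (v : ℂ) : Integrable fun z => ψ z * fderiv ℝ (fderiv ℝ η) z v v :=
      (hψ.continuous.mul (hcont2 hη v)).integrable_of_hasCompactSupport (hc2 v).mul_left
    have hi2 (v : ℂ) : Integrable fun z => fderiv ℝ (fderiv ℝ ψ) z v v * η z :=
      ((hcont2 hψ v).mul hη.continuous).integrable_of_hasCompactSupport hc.mul_left
    rw [laplacianMeasure, integral_withDensity_eq_integral_toReal_smul
      hcont.measurable.ennreal_ofReal (Eventually.of_forall fun z => ENNReal.ofReal_lt_top)]
    simp_rw [ENNReal.toReal_ofReal (hΔ _), EReal.toReal_coe, smul_eq_mul,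
      laplacian_eq_fderiv_fderiv, mul_add, add_mul]
    rw [integral_add (hi1 1) (hi1 Complex.I), integral_add (hi2 1) (hi2 Complex.I),
      integral_mul_fderiv_fderiv_comm hψ hη hc, integral_mul_fderiv_fderiv_comm hψ hη hc]

end Green

/-! ### The regularized function -/

section Regularization

theorem bump_eq_scaled (w : ℂ) (s : ℝ) :
    bump (w, s) = Real.exp (-2 * s) * bump (Real.exp (-s) • w, 0) := by
  simp only [bump, scaledNormSq_eq_norm_smul]
  simp
  ring

theorem hasCompactSupport_bump_zero : HasCompactSupport fun w : ℂ => bump (w, 0) :=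
  HasCompactSupport.intro (isCompact_closedBall 0 1) fun w hw => bump_eq_zero (by
    simp only [mem_closedBall, dist_zero_right, not_le] at hw
    simpa using hw.le)

theorem contDiff_bump_left (s : ℝ) : ContDiff ℝ ∞ fun w : ℂ => bump (w, s) :=
  contDiff_bump.comp (contDiff_id.prodMk contDiff_const)

theorem exists_bump_le : ∃ C, 0 < C ∧ ∀ w s, bump (w, s) ≤ C * Real.exp (-2 * s) := by
  obtain ⟨C, hC⟩ := hasCompactSupport_bump_zero.exists_bound_of_continuous
    (contDiff_bump_left 0).continuous
  refine ⟨|C| + 1, by positivity, fun w s => ?_⟩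
  rw [bump_eq_scaled, mul_comm]
  gcongr
  have := (le_abs_self _).trans (hC (Real.exp (-s) • w))
  linarith [le_abs_self C]

theorem exists_norm_fderiv_bump_le : ∃ C, 0 < C ∧ ∀ w s,
    ‖fderiv ℝ (fun w => bump (w, s)) w‖ ≤ C * Real.exp (-3 * s) := by
  obtain ⟨C, hC⟩ := (hasCompactSupport_bump_zero.fderiv (𝕜 := ℝ)).exists_bound_of_continuous
    ((contDiff_bump_left 0).fderiv_right (m := ∞) (by simp)).continuous
  refine ⟨|C| + 1, by positivity, fun w s => ?_⟩
  have h : (fun w => bump (w, s)) =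
      fun w => Real.exp (-2 * s) • (fun w => bump (w, 0)) (Real.exp (-s) • w) := by
    funext w
    rw [bump_eq_scaled, smul_eq_mul]
  have hd : Differentiable ℝ fun w : ℂ => bump (w, 0) :=
    (contDiff_bump_left 0).differentiable (by simp)
  have hd' : DifferentiableAt ℝ (fun w => (fun w => bump (w, 0)) (Real.exp (-s) • w)) w :=
    (hd _).comp w (differentiableAt_id.const_smul (Real.exp (-s)) : DifferentiableAt ℝ
      (fun w : ℂ => Real.exp (-s) • w) w)
  have h1 : fderiv ℝ (fun w => (fun w => bump (w, 0)) (Real.exp (-s) • w)) w =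
      Real.exp (-s) • fderiv ℝ (fun w => bump (w, 0)) (Real.exp (-s) • w) :=
    fderiv_comp_smul (f := fun w => bump (w, 0)) (Real.exp (-s))
  rw [h, fderiv_fun_const_smul hd', h1, norm_smul, norm_smul, ← mul_assoc,
    Real.norm_eq_abs, Real.norm_eq_abs, abs_of_pos (Real.exp_pos _), abs_of_pos (Real.exp_pos _),
    ← Real.exp_add, mul_comm, show -2 * s + -s = -3 * s by ring]
  gcongr
  have := hC (Real.exp (-s) • w)
  linarith [le_abs_self C]

variable {φ : ℂ → EReal} {μ : Measure ℂ}

/-- The logarithm of the scale `ρ_μ(ζ) / 32` on which the mass of `μ` near `ζ` is spread out. -/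
noncomputable def logScale (μ : Measure ℂ) (ζ : ℂ) : ℝ := Real.log (massRadius μ ζ / 32)

/-- With `μ` the Laplacian of `φ`, the function obtained from `φ` by spreading out each mass `dμ(ζ)`
over the disc of radius `ρ_μ(ζ) / 32` around `ζ`. It is written as the mean of `φ` on the fixed
scale `1` corrected by smooth potentials, so that its smoothness is evident. -/
noncomputable def regularization (φ : ℂ → EReal) (μ : Measure ℂ) (z : ℂ) : ℝ :=
  mollification (fun z => (φ z).toReal) 0 z + ∫ ζ, potential (z - ζ, logScale μ ζ) ∂μ

/-- The density of the measure `μ` spread out on the scale `ρ_μ / 32`. -/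
noncomputable def spreadDensity (μ : Measure ℂ) (z : ℂ) : ℝ :=
  ∫ ζ, bump (z - ζ, logScale μ ζ) ∂μ

section Smooth

variable [IsLocallyFiniteMeasure μ] (hd : IsDoubling μ) (h0 : μ ≠ 0)
include hd h0

theorem exp_logScale (ζ : ℂ) : Real.exp (logScale μ ζ) = massRadius μ ζ / 32 :=
  Real.exp_log (by linarith [hd.massRadius_pos h0 ζ])

theorem continuous_logScale : Continuous (logScale μ) :=
  ((hd.continuous_massRadius h0).div_const 32).log fun ζ => by
    linarith [hd.massRadius_pos h0 ζ]

theorem exp_logScale_le (ζ : ℂ) : Real.exp (logScale μ ζ) ≤ massRadius μ 0 + ‖ζ‖ / 2 := by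
  rw [exp_logScale hd h0]
  have h1 := hd.massRadius_le_add_dist h0 ζ 0
  have h2 := hd.massRadius_pos h0 0
  have h3 := norm_nonneg ζ
  rw [dist_zero_right] at h1
  linarith

theorem contDiff_regularization (hμ : IsDistribLaplacian φ μ) :
    ContDiff ℝ ∞ (regularization φ μ) := by
  have h1 : ContDiff ℝ ∞ (mollification (fun z => (φ z).toReal) 0) :=
    contDiff_integral_param hμ.locallyIntegrable
      (continuous_id.prodMk continuous_const) (contDiff_translate contDiff_bump)
      (locallyCompactlySupported_bump volume (exp_const_le 0))
  have h2 := contDiff_integral_param (g := fun _ => 1) (locallyIntegrable_const (μ := μ) _)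
    (continuous_id.prodMk (continuous_logScale hd h0)) (contDiff_translate contDiff_potential)
    (locallyCompactlySupported_potential μ (exp_logScale_le hd h0))
  simp only [one_smul] at h2
  exact h1.add h2

/-- The mollified mass on the scale `1` cancels against the Laplacian of the potentials. -/
theorem laplacian_regularization (hμ : IsDistribLaplacian φ μ) (z : ℂ) :
    (Δ (regularization φ μ)) z = spreadDensity μ z := by
  have h1 : ContDiff ℝ ∞ (mollification (fun z => (φ z).toReal) 0) :=
    contDiff_integral_param hμ.locallyIntegrable
      (continuous_id.prodMk continuous_const) (contDiff_translate contDiff_bump)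
      (locallyCompactlySupported_bump volume (exp_const_le 0))
  have h2 := contDiff_integral_param (g := fun _ => 1) (locallyIntegrable_const (μ := μ) _)
    (continuous_id.prodMk (continuous_logScale hd h0)) (contDiff_translate contDiff_potential)
    (locallyCompactlySupported_potential μ (exp_logScale_le hd h0))
  have h3 := laplacian_integral_param (g := fun _ => 1) (locallyIntegrable_const (μ := μ) _)
    (continuous_id.prodMk (continuous_logScale hd h0)) (contDiff_translate contDiff_potential)
    (locallyCompactlySupported_potential μ (exp_logScale_le hd h0)) z
  simp only [one_smul, id, one_mul, laplacian_potential] at h2 h3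
  have h4 : regularization φ μ = mollification (fun z => (φ z).toReal) 0 +
      fun z => ∫ ζ, potential (z - ζ, logScale μ ζ) ∂μ := rfl
  have hi1 := integrable_mul_bump (g := fun _ => 1) (locallyIntegrable_const (μ := μ) _)
    (continuous_logScale hd h0) (exp_logScale_le hd h0) z
  have hi2 := integrable_mul_bump (g := fun _ => 1) (locallyIntegrable_const (μ := μ) _)
    continuous_const (exp_const_le 0) z
  simp only [one_mul] at hi1 hi2
  rw [h4, (contDiff_infty.1 h1 2).contDiffAt.laplacian_add (contDiff_infty.1 h2 2).contDiffAt,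
    hμ.laplacian_mollification, h3, integral_sub hi1 hi2, spreadDensity]
  ring

/-- On discs whose radius is at most half the mass radius at the centre, the mass radius varies by
at most a factor `2`. -/
theorem massRadius_mem_Icc {z ζ : ℂ} (h : ‖z - ζ‖ ≤ massRadius μ z / 2) :
    massRadius μ ζ ∈ Icc (massRadius μ z / 2) (2 * massRadius μ z) := by
  have h1 := hd.massRadius_le_add_dist h0 z ζ
  have h2 := hd.massRadius_le_add_dist h0 ζ z
  rw [dist_eq_norm] at h1 h2
  rw [norm_sub_rev] at h2
  have := hd.massRadius_pos h0 z
  constructor <;> linarith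

/-- The mass of points at distance at least `ρ_μ(z) / 2` is not spread as far as `z`. -/
theorem exp_logScale_lt_of_half_le {z ζ : ℂ} (h : massRadius μ z / 2 ≤ ‖z - ζ‖) :
    Real.exp (logScale μ ζ) < ‖z - ζ‖ := by
  rw [exp_logScale hd h0]
  have h2 := hd.massRadius_le_add_dist h0 ζ z
  rw [dist_eq_norm, norm_sub_rev] at h2
  have := hd.massRadius_pos h0 z
  linarith

omit hd h0 in
theorem norm_integral_le_of_le_on_ball {F : Type*} [NormedAddCommGroup F] [NormedSpace ℝ F]
    {f : ℂ → F} {z : ℂ} {r K : ℝ} (hr : μ (ball z r) ≤ 1)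
    (h : ∀ ζ ∈ ball z r, ‖f ζ‖ ≤ K) (h' : ∀ ζ ∉ ball z r, f ζ = 0) : ‖∫ ζ, f ζ ∂μ‖ ≤ |K| := by
  rw [← setIntegral_eq_integral_of_forall_compl_eq_zero h']
  refine (norm_setIntegral_le_of_norm_le_const (measure_ball_lt_top)
    fun ζ hζ => (h ζ hζ).trans (le_abs_self K)).trans ?_
  refine mul_le_of_le_one_right (abs_nonneg _) ?_
  simpa [Measure.real] using ENNReal.toReal_mono ENNReal.one_ne_top hr

theorem measure_ball_half_le (z : ℂ) : μ (ball z (massRadius μ z / 2)) ≤ 1 := by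
  rw [← hd.measure_ball_massRadius h0 z]
  exact measure_mono (ball_subset_ball (by linarith [hd.massRadius_pos h0 z]))

theorem exp_neg_mul_logScale (n : ℕ) (ζ : ℂ) :
    Real.exp (-n * logScale μ ζ) = (32 / massRadius μ ζ) ^ n := by
  rw [neg_mul, Real.exp_neg, Real.exp_nat_mul, exp_logScale hd h0, ← inv_pow, inv_div]

theorem exp_neg_mul_logScale_le (n : ℕ) {z ζ : ℂ} (h : ‖z - ζ‖ ≤ massRadius μ z / 2) :
    Real.exp (-n * logScale μ ζ) ≤ (64 / massRadius μ z) ^ n := by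
  have h1 := hd.massRadius_pos h0 z
  have h2 := (massRadius_mem_Icc hd h0 h).1
  rw [exp_neg_mul_logScale hd h0]
  have h3 : 32 / massRadius μ ζ ≤ 64 / massRadius μ z := by
    rw [div_le_div_iff₀ (by linarith) h1]
    linarith
  have h4 : 0 ≤ 32 / massRadius μ ζ := div_nonneg (by norm_num) (by linarith)
  gcongr

/-- The points that contribute to the density at `z` lie near `z`, are spread over radii comparable
to `ρ_μ(z)`, and have total mass at most `1`. -/
theorem exists_spreadDensity_le :
    ∃ C, 0 < C ∧ ∀ z, spreadDensity μ z ≤ C / massRadius μ z ^ 2 := by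
  obtain ⟨C, hC0, hC⟩ := exists_bump_le
  refine ⟨C * 64 ^ 2, by positivity, fun z => ?_⟩
  have h := norm_integral_le_of_le_on_ball (f := fun ζ => bump (z - ζ, logScale μ ζ))
    (K := C * (64 / massRadius μ z) ^ 2) (measure_ball_half_le hd h0 z)
    (fun ζ hζ => by
      have hζ' : ‖z - ζ‖ ≤ massRadius μ z / 2 := by
        rw [norm_sub_rev]; exact (mem_ball_iff_norm.1 hζ).le
      rw [Real.norm_eq_abs, abs_of_nonneg (bump_nonneg _)]
      refine (hC _ _).trans ?_
      gcongr
      exact_mod_cast exp_neg_mul_logScale_le hd h0 2 hζ')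
    (fun ζ hζ => bump_eq_zero (exp_logScale_lt_of_half_le hd h0 (by
      rw [norm_sub_rev]; exact not_lt.1 fun h => hζ (mem_ball_iff_norm.2 h))).le)
  have h1 := hd.massRadius_pos h0 z
  rw [abs_of_nonneg (by positivity)] at h
  refine (le_abs_self _).trans (h.trans_eq ?_)
  rw [div_pow]; ring

/-- For sources in the disc of radius `ρ_μ(z) / 128`, which by doubling has mass bounded below, the
mollifiers take at `z` the value that they have near their centre, comparable to `ρ_μ(z)⁻²`. -/
theorem exists_le_spreadDensity :
    ∃ c, 0 < c ∧ ∀ z, c / massRadius μ z ^ 2 ≤ spreadDensity μ z := by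
  obtain ⟨C, hC⟩ := id hd
  have hm (z : ℂ) : 1 ≤ (C : ℝ) ^ 7 * μ.real (ball z (massRadius μ z / 128)) := by
    have h1 := measure_ball_two_pow_le hC 7 z
      (show 0 < massRadius μ z / 128 by linarith [hd.massRadius_pos h0 z])
    rw [show (2 : ℝ) ^ 7 * (massRadius μ z / 128) = massRadius μ z by ring,
      hd.measure_ball_massRadius h0] at h1
    have := ENNReal.toReal_mono (ENNReal.mul_ne_top (by simp) measure_ball_lt_top.ne) h1
    simpa [Measure.real] using this
  have hC7 : 0 < (C : ℝ) ^ 7 := by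
    by_contra! h
    nlinarith [hm 0, measureReal_nonneg (μ := μ) (s := ball (0 : ℂ) (massRadius μ 0 / 128))]
  have hp := profileMass_pos
  refine ⟨profileMass⁻¹ * 16 ^ 2 / C ^ 7, by positivity, fun z => ?_⟩
  have h1 := hd.massRadius_pos h0 z
  have hi := integrable_mul_bump (g := fun _ => 1) (locallyIntegrable_const (μ := μ) _)
    (continuous_logScale hd h0) (exp_logScale_le hd h0) z
  simp only [one_mul] at hi
  calc profileMass⁻¹ * 16 ^ 2 / C ^ 7 / massRadius μ z ^ 2
      = 1 / C ^ 7 * (profileMass⁻¹ * (16 / massRadius μ z) ^ 2) := by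
        rw [div_pow]; ring
    _ ≤ μ.real (ball z (massRadius μ z / 128)) *
          (profileMass⁻¹ * (16 / massRadius μ z) ^ 2) := by
        gcongr
        rw [div_le_iff₀ hC7, mul_comm]
        exact hm z
    _ = ∫ ζ in ball z (massRadius μ z / 128), profileMass⁻¹ * (16 / massRadius μ z) ^ 2 ∂μ := by
        rw [setIntegral_const, smul_eq_mul]
    _ ≤ ∫ ζ in ball z (massRadius μ z / 128), bump (z - ζ, logScale μ ζ) ∂μ := by
        refine setIntegral_mono_on (integrableOn_const measure_ball_lt_top.ne) hi.integrableOn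
          measurableSet_ball fun ζ hζ => ?_
        have hζ' : ‖z - ζ‖ < massRadius μ z / 128 := by
          rw [norm_sub_rev]; exact mem_ball_iff_norm.1 hζ
        have h2 := massRadius_mem_Icc hd h0 (z := z) (ζ := ζ) (by linarith)
        have h3 := hd.massRadius_pos h0 ζ
        rw [bump_eq_of_norm_lt (by rw [exp_logScale hd h0]; linarith [h2.1])]
        have h4 := exp_neg_mul_logScale hd h0 2 ζ
        push_cast at h4
        rw [h4]
        have h5 : 16 / massRadius μ z ≤ 32 / massRadius μ ζ := by
          rw [div_le_div_iff₀ h1 h3]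
          linarith [h2.2]
        gcongr
    _ ≤ spreadDensity μ z :=
        setIntegral_le_integral hi (Eventually.of_forall fun ζ => bump_nonneg _)

theorem exists_norm_fderiv_spreadDensity_le :
    ∃ C, 0 < C ∧ ∀ z, ‖fderiv ℝ (spreadDensity μ) z‖ ≤ C / massRadius μ z ^ 3 := by
  obtain ⟨C, hC0, hC⟩ := exists_norm_fderiv_bump_le
  refine ⟨C * 64 ^ 3, by positivity, fun z => ?_⟩
  have h1 := hasFDerivAt_integral_param (g := fun _ => 1) (locallyIntegrable_const (μ := μ) _)
    (continuous_id.prodMk (continuous_logScale hd h0)) (contDiff_translate contDiff_bump)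
    (locallyCompactlySupported_bump μ (exp_logScale_le hd h0)) z
  simp only [one_smul, id] at h1
  have h2 : HasFDerivAt (spreadDensity μ) _ z := h1
  rw [h2.fderiv]
  have h3 (ζ : ℂ) : partialFDeriv (fun q : ℂ × (ℂ × ℝ) => bump (q.1 - q.2.1, q.2.2))
      (z, (ζ, logScale μ ζ)) = fderiv ℝ (fun w => bump (w, logScale μ ζ)) (z - ζ) := by
    rw [← (hasFDerivAt_partial (contDiff_translate contDiff_bump) z (ζ, logScale μ ζ)).fderiv]
    exact fderiv_comp_sub (f := fun w => bump (w, logScale μ ζ)) ζ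
  simp_rw [h3]
  have h := norm_integral_le_of_le_on_ball
    (f := fun ζ => fderiv ℝ (fun w => bump (w, logScale μ ζ)) (z - ζ))
    (K := C * (64 / massRadius μ z) ^ 3) (measure_ball_half_le hd h0 z)
    (fun ζ hζ => by
      have hζ' : ‖z - ζ‖ ≤ massRadius μ z / 2 := by
        rw [norm_sub_rev]; exact (mem_ball_iff_norm.1 hζ).le
      refine (hC _ _).trans ?_
      gcongr
      exact_mod_cast exp_neg_mul_logScale_le hd h0 3 hζ')
    (fun ζ hζ => by
      have h4 := exp_logScale_lt_of_half_le hd h0 (z := z) (ζ := ζ) (by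
        rw [norm_sub_rev]; exact not_lt.1 fun h => hζ (mem_ball_iff_norm.2 h))
      have h5 : (fun w => bump (w, logScale μ ζ)) =ᶠ[𝓝 (z - ζ)] fun _ => 0 := by
        filter_upwards [continuous_norm.continuousAt.eventually_const_lt h4] with w hw
        exact bump_eq_zero hw.le
      rw [h5.fderiv_eq]
      simp)
  have h1 := hd.massRadius_pos h0 z
  rw [abs_of_nonneg (by positivity)] at h
  refine h.trans_eq ?_
  rw [div_pow]; ring

/-- Replacing the variable scale `ρ_μ(ζ) / 32` by its value at `z` changes the regularization by
a bounded amount at `z`. -/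
theorem abs_regularization_sub_mollification_le (hμ : IsDistribLaplacian φ μ) (z : ℂ) :
    |regularization φ μ z - mollification (fun z => (φ z).toReal) (logScale μ z) z| ≤
      (2 * profileMass)⁻¹ * Real.log 2 := by
  have hp := profileMass_pos
  have hl : 0 < Real.log 2 := Real.log_pos (by norm_num)
  have h1 := hμ.mollification_sub (logScale μ z) z
  have h2 : regularization φ μ z - mollification (fun z => (φ z).toReal) (logScale μ z) z =
      ∫ ζ, (potential (z - ζ, logScale μ ζ) - potential (z - ζ, logScale μ z)) ∂μ := by
    rw [integral_sub (integrable_potential (continuous_logScale hd h0) (exp_logScale_le hd h0) z)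
      (integrable_potential continuous_const (exp_const_le _) z), ← h1, regularization]
    ring
  rw [h2, ← Real.norm_eq_abs]
  refine (norm_integral_le_of_le_on_ball (K := (2 * profileMass)⁻¹ * Real.log 2)
    (measure_ball_half_le hd h0 z) ?_ ?_).trans_eq (abs_of_nonneg (by positivity))
  · intro ζ hζ
    have hζ' : ‖z - ζ‖ ≤ massRadius μ z / 2 := by
      rw [norm_sub_rev]; exact (mem_ball_iff_norm.1 hζ).le
    have h3 := massRadius_mem_Icc hd h0 hζ'
    have h4 := hd.massRadius_pos h0 z
    have h5 := hd.massRadius_pos h0 ζ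
    have h6 : logScale μ ζ ≤ logScale μ z + Real.log 2 := by
      rw [logScale, logScale, ← Real.log_mul (by positivity) (by norm_num)]
      exact Real.log_le_log (by positivity) (by linarith [h3.2])
    have h7 : logScale μ z ≤ logScale μ ζ + Real.log 2 := by
      rw [logScale, logScale, ← Real.log_mul (by positivity) (by norm_num)]
      exact Real.log_le_log (by positivity) (by linarith [h3.1])
    rcases le_total (logScale μ ζ) (logScale μ z) with h | h
    · have h8 := potential_sub_mem (w := z - ζ) h
      rw [norm_sub_rev, Real.norm_eq_abs, abs_of_nonneg h8.1]
      refine h8.2.trans ?_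
      gcongr
      linarith
    · have h8 := potential_sub_mem (w := z - ζ) h
      rw [Real.norm_eq_abs, abs_of_nonneg h8.1]
      refine h8.2.trans ?_
      gcongr
      linarith
  · intro ζ hζ
    have h3 : massRadius μ z / 2 ≤ ‖z - ζ‖ := by
      rw [norm_sub_rev]; exact not_lt.1 fun h => hζ (mem_ball_iff_norm.2 h)
    have h4 := hd.massRadius_pos h0 z
    rw [potential_eq_of_le (exp_logScale_lt_of_half_le hd h0 h3).le
      (s' := logScale μ z) (by rw [exp_logScale hd h0]; linarith), sub_self]

theorem exists_regularization_sub_le (hφ : Subharmonic φ) (hμ : IsDistribLaplacian φ μ) :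
    ∃ C : ℝ, 0 < C ∧ ∀ z, ((regularization φ μ z - C : ℝ) : EReal) ≤ φ z ∧
      φ z ≤ ((regularization φ μ z + C : ℝ) : EReal) := by
  obtain ⟨γ, hγ0, hγ1, hγ⟩ := hd.exists_reverse
  have hp := profileMass_pos
  have hl : 0 < Real.log 2 := Real.log_pos (by norm_num)
  have hl3 : 0 < Real.log 3 := Real.log_pos (by norm_num)
  have hγ' : 0 < 1 - γ := by linarith
  set c₁ := (2 * profileMass)⁻¹ * Real.log 2
  set c₂ := (2 * profileMass)⁻¹ * Real.log 3 / (1 - γ)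
  have hc₁ : 0 < c₁ := by positivity
  have hc₂ : 0 < c₂ := by positivity
  refine ⟨c₁ + c₂, by positivity, fun z => ?_⟩
  have h1 := abs_le.1 (abs_regularization_sub_mollification_le hd h0 hμ z)
  have h2 := hφ.le_mollification hμ.locallyIntegrable z (logScale μ z)
  have h3 := hφ.mollification_sub_le hμ hγ0 hγ1 hγ z (logScale μ z)
  have h4 : μ.real (ball z (Real.exp (logScale μ z))) ≤ 1 := by
    have h5 : μ (ball z (Real.exp (logScale μ z))) ≤ 1 := by
      rw [exp_logScale hd h0, ← hd.measure_ball_massRadius h0 z]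
      exact measure_mono (ball_subset_ball (by linarith [hd.massRadius_pos h0 z]))
    simpa [Measure.real] using ENNReal.toReal_mono ENNReal.one_ne_top h5
  constructor
  · refine le_trans (EReal.coe_le_coe_iff.2 ?_) h3
    have : c₂ * μ.real (ball z (Real.exp (logScale μ z))) ≤ c₂ := mul_le_of_le_one_right hc₂.le h4
    linarith [h1.2]
  · refine h2.trans (EReal.coe_le_coe_iff.2 ?_)
    linarith [h1.1]

end Smooth

end Regularization

/-! ### The spread-out measure -/

section SpreadMeasure

variable {μ : Measure ℂ}

/-- The measure `μ` spread out on the scale `ρ_μ / 32`. -/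
noncomputable def spreadMeasure (μ : Measure ℂ) : Measure ℂ :=
  volume.withDensity fun z => ENNReal.ofReal (spreadDensity μ z)

theorem lintegral_bump_translate (ζ : ℂ) (s : ℝ) :
    ∫⁻ w, ENNReal.ofReal (bump (w - ζ, s)) = 1 := by
  rw [lintegral_sub_right_eq_self (fun w => ENNReal.ofReal (bump (w, s))), lintegral_ofReal_bump]

variable [IsLocallyFiniteMeasure μ] (hd : IsDoubling μ) (h0 : μ ≠ 0)
include hd h0

theorem measurable_bump_logScale :
    Measurable fun p : ℂ × ℂ => ENNReal.ofReal (bump (p.1 - p.2, logScale μ p.2)) := by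
  have := continuous_logScale hd h0
  have h := contDiff_bump.continuous
  exact (h.comp (by fun_prop)).measurable.ennreal_ofReal

theorem spreadMeasure_ball (z : ℂ) (R : ℝ) : spreadMeasure μ (ball z R) =
    ∫⁻ ζ, (∫⁻ w in ball z R, ENNReal.ofReal (bump (w - ζ, logScale μ ζ))) ∂μ := by
  have h1 (w : ℂ) : ENNReal.ofReal (spreadDensity μ w) =
      ∫⁻ ζ, ENNReal.ofReal (bump (w - ζ, logScale μ ζ)) ∂μ := by
    have hi := integrable_mul_bump (g := fun _ => 1) (locallyIntegrable_const (μ := μ) _)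
      (continuous_logScale hd h0) (exp_logScale_le hd h0) w
    simp only [one_mul] at hi
    exact ofReal_integral_eq_lintegral_ofReal hi (Eventually.of_forall fun ζ => bump_nonneg _)
  rw [spreadMeasure, withDensity_apply _ measurableSet_ball]
  simp_rw [h1]
  exact lintegral_lintegral_swap (measurable_bump_logScale hd h0).aemeasurable

/-- Spreading out carries no mass into `D(z, R)` from outside `D(z, 3 R)`, as long as `R` is not
small compared with the mass radius. -/
theorem spreadMeasure_ball_le {z : ℂ} {R : ℝ} (hR : massRadius μ z / 16 ≤ R) :
    spreadMeasure μ (ball z R) ≤ μ (ball z (3 * R)) := by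
  rw [spreadMeasure_ball hd h0, ← lintegral_indicator_one measurableSet_ball]
  refine lintegral_mono fun ζ => ?_
  by_cases hζ : ζ ∈ ball z (3 * R)
  · rw [indicator_of_mem hζ, Pi.one_apply, ← lintegral_bump_translate ζ (logScale μ ζ)]
    exact setLIntegral_le_lintegral _ _
  · rw [indicator_of_notMem hζ, nonpos_iff_eq_zero,
      setLIntegral_congr_fun (g := fun _ => 0) measurableSet_ball fun w hw => ?_, lintegral_zero]
    simp only [mem_ball, not_lt] at hζ hw
    have h1 := dist_triangle ζ w z
    have h2 := hd.massRadius_le_add_dist h0 ζ z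
    simp only
    rw [bump_eq_zero, ENNReal.ofReal_zero]
    rw [exp_logScale hd h0, ← dist_eq_norm, dist_comm]
    linarith [dist_nonneg (x := w) (y := z)]

/-- Spreading out keeps the mass of `D(z, R / 4)` inside `D(z, R)`, as long as `R` is not small
compared with the mass radius. -/
theorem le_spreadMeasure_ball {z : ℂ} {R : ℝ} (hR : massRadius μ z / 16 ≤ R) :
    μ (ball z (R / 4)) ≤ spreadMeasure μ (ball z R) := by
  rw [spreadMeasure_ball hd h0, ← lintegral_indicator_one measurableSet_ball]
  refine lintegral_mono fun ζ => ?_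
  by_cases hζ : ζ ∈ ball z (R / 4)
  · rw [indicator_of_mem hζ, Pi.one_apply, ← lintegral_bump_translate ζ (logScale μ ζ),
      ← lintegral_indicator measurableSet_ball]
    refine lintegral_mono fun w => ?_
    by_cases hw : w ∈ ball z R
    · rw [indicator_of_mem hw]
    · simp only [mem_ball, not_lt] at hζ hw
      have h1 := dist_triangle w ζ z
      have h2 := hd.massRadius_le_add_dist h0 ζ z
      rw [bump_eq_zero, ENNReal.ofReal_zero]
      · exact zero_le
      · rw [exp_logScale hd h0, ← dist_eq_norm]
        linarith [hd.massRadius_pos h0 z]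
  · rw [indicator_of_notMem hζ]
    exact zero_le

/-- On large discs the spread-out measure inherits the doubling property from `μ`; on small
ones its density is comparable to a constant. -/
theorem isDoubling_spreadMeasure : IsDoubling (spreadMeasure μ) := by
  obtain ⟨C, hC⟩ := id hd
  obtain ⟨C₁, hC₁0, hC₁⟩ := exists_spreadDensity_le hd h0
  obtain ⟨c, hc0, hc⟩ := exists_le_spreadDensity hd h0
  refine ⟨max (C ^ 5) (Real.toNNReal (64 * C₁ / c)), fun z R hR => ?_⟩
  rcases le_or_gt (massRadius μ z / 16) R with h | h
  · calc spreadMeasure μ (ball z (2 * R)) ≤ μ (ball z (3 * (2 * R))) :=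
          spreadMeasure_ball_le hd h0 (by linarith)
      _ ≤ μ (ball z (2 ^ 5 * (R / 4))) := measure_mono (ball_subset_ball (by linarith))
      _ ≤ C ^ 5 * μ (ball z (R / 4)) := measure_ball_two_pow_le hC 5 z (by linarith)
      _ ≤ _ := mul_le_mul' (by exact_mod_cast le_max_left _ _) (le_spreadMeasure_ball hd h0 h)
  · have hρ := hd.massRadius_pos h0 z
    have hcomp {w : ℂ} (hw : w ∈ ball z (2 * R)) := massRadius_mem_Icc hd h0 (z := z) (ζ := w) (by
      rw [norm_sub_rev]
      linarith [mem_ball_iff_norm.1 hw])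
    have hup : spreadMeasure μ (ball z (2 * R)) ≤
        ENNReal.ofReal (4 * C₁ / massRadius μ z ^ 2) * volume (ball z (2 * R)) := by
      rw [spreadMeasure, withDensity_apply _ measurableSet_ball, ← setLIntegral_const]
      refine setLIntegral_mono' measurableSet_ball fun w hw => ENNReal.ofReal_le_ofReal ?_
      refine (hC₁ w).trans ?_
      have h1 := (hcomp hw).1
      have h2 := hd.massRadius_pos h0 w
      rw [div_le_div_iff₀ (by positivity) (by positivity)]
      have : massRadius μ z ^ 2 ≤ (2 * massRadius μ w) ^ 2 := by gcongr; linarith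
      nlinarith
    have hlow : ENNReal.ofReal (c / (4 * massRadius μ z ^ 2)) * volume (ball z R) ≤
        spreadMeasure μ (ball z R) := by
      rw [spreadMeasure, withDensity_apply _ measurableSet_ball, ← setLIntegral_const]
      refine setLIntegral_mono' measurableSet_ball fun w hw => ENNReal.ofReal_le_ofReal ?_
      refine le_trans ?_ (hc w)
      have h1 := (hcomp (ball_subset_ball (by linarith) hw)).2
      have h2 := hd.massRadius_pos h0 w
      rw [div_le_div_iff₀ (by positivity) (by positivity)]
      have : massRadius μ w ^ 2 ≤ (2 * massRadius μ z) ^ 2 := by gcongr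
      nlinarith
    calc spreadMeasure μ (ball z (2 * R))
        ≤ ENNReal.ofReal (4 * C₁ / massRadius μ z ^ 2) * volume (ball z (2 * R)) := hup
      _ = ENNReal.ofReal (64 * C₁ / c) *
          (ENNReal.ofReal (c / (4 * massRadius μ z ^ 2)) * volume (ball z R)) := by
        rw [Complex.volume_ball, Complex.volume_ball, ← mul_assoc, ← mul_assoc, ← mul_assoc,
          ← ENNReal.ofReal_mul (by positivity), ← ENNReal.ofReal_pow (by linarith),
          ← ENNReal.ofReal_pow hR.le, ← ENNReal.ofReal_mul (by positivity),
          ← ENNReal.ofReal_mul (by positivity)]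
        congr 2
        field_simp
        ring
      _ ≤ _ := mul_le_mul' (ENNReal.coe_le_coe.2 (le_max_right _ _)) hlow

theorem spreadMeasure_ne_zero : spreadMeasure μ ≠ 0 := by
  intro h
  have h1 := le_spreadMeasure_ball hd h0 (z := 0) (R := 4 * massRadius μ 0)
    (by linarith [hd.massRadius_pos h0 0])
  rw [h, mul_div_cancel_left₀ _ (by norm_num), hd.measure_ball_massRadius h0] at h1
  simp at h1

theorem massRadius_spreadMeasure_mem [IsLocallyFiniteMeasure (spreadMeasure μ)] (z : ℂ) :
    massRadius (spreadMeasure μ) z ∈ Icc (massRadius μ z / 16) (4 * massRadius μ z) := by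
  have hρ := hd.massRadius_pos h0 z
  have hd' := isDoubling_spreadMeasure hd h0
  constructor
  · refine hd'.le_massRadius (spreadMeasure_ne_zero hd h0) ?_
    obtain ⟨γ, hγ0, hγ1, hγ⟩ := hd.exists_reverse
    refine (spreadMeasure_ball_le hd h0 le_rfl).trans_lt ?_
    refine (measure_mono (ball_subset_ball
      (show 3 * (massRadius μ z / 16) ≤ massRadius μ z / 3 by linarith))).trans_lt ?_
    have h1 := hγ z (massRadius μ z / 3) (by linarith)
    rw [mul_div_cancel₀ _ (by norm_num : (3 : ℝ) ≠ 0)] at h1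
    have h2 : μ.real (ball z (massRadius μ z)) = 1 := by
      simp [Measure.real, hd.measure_ball_massRadius h0]
    rw [h2, mul_one] at h1
    rw [← ENNReal.toReal_lt_toReal measure_ball_lt_top.ne ENNReal.one_ne_top, ENNReal.toReal_one]
    exact h1.trans_lt hγ1
  · refine hd'.massRadius_le ?_
    have h1 := le_spreadMeasure_ball hd h0 (z := z) (R := 4 * massRadius μ z) (by linarith)
    rwa [mul_div_cancel_left₀ _ (by norm_num), hd.measure_ball_massRadius h0] at h1

end SpreadMeasure

theorem mainTheorem6 (φ : ℂ → EReal) (μ : Measure ℂ) (hφ : Subharmonic φ)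
    (hμ : IsDistribLaplacian φ μ) (hdoubling : IsDoubling μ) (hne : μ ≠ 0) :
    ∃ (ψ : ℂ → ℝ) (ν : Measure ℂ),
      ContDiff ℝ ∞ ψ ∧
      Subharmonic (fun z => (ψ z : EReal)) ∧
      (∃ C : ℝ, 0 < C ∧ ∀ z, ((ψ z - C : ℝ) : EReal) ≤ φ z ∧ φ z ≤ ((ψ z + C : ℝ) : EReal)) ∧
      IsDistribLaplacian (fun z => (ψ z : EReal)) ν ∧
      IsDoubling ν ∧
      Comparable (Δ ψ) (fun z => 1 / massRadius ν z ^ 2) ∧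
      Comparable (fun z => 1 / massRadius ν z ^ 2) (fun z => 1 / massRadius μ z ^ 2) ∧
      Lesssim (fun z => ‖gradient (Δ ψ) z‖) (fun z => 1 / massRadius μ z ^ 3) := by
  have := hμ.locallyFinite
  have hψ := contDiff_regularization hdoubling hne hμ
  have hΔ : Δ (regularization φ μ) = spreadDensity μ :=
    funext (laplacian_regularization hdoubling hne hμ)
  have hΔ0 (z : ℂ) : 0 ≤ (Δ (regularization φ μ)) z := by
    rw [hΔ]
    exact integral_nonneg fun ζ => bump_nonneg _
  have hν := hψ.isDistribLaplacian hΔ0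
  have hνμ : laplacianMeasure (regularization φ μ) = spreadMeasure μ := by
    rw [laplacianMeasure, hΔ, spreadMeasure]
  rw [hνμ] at hν
  have := hν.locallyFinite
  have hd' := isDoubling_spreadMeasure hdoubling hne
  obtain ⟨C₁, hC₁0, hC₁⟩ := exists_spreadDensity_le hdoubling hne
  obtain ⟨c, hc0, hc⟩ := exists_le_spreadDensity hdoubling hne
  obtain ⟨C₃, hC₃0, hC₃⟩ := exists_norm_fderiv_spreadDensity_le hdoubling hne
  have hρ (z : ℂ) := hdoubling.massRadius_pos hne z
  have hρ' (z : ℂ) := hd'.massRadius_pos (spreadMeasure_ne_zero hdoubling hne) z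
  have hle (z : ℂ) : 1 / massRadius (spreadMeasure μ) z ^ 2 ≤
      16 ^ 2 * (1 / massRadius μ z ^ 2) := by
    have h1 := (massRadius_spreadMeasure_mem hdoubling hne z).1
    have h2 := hρ z
    have h3 := hρ' z
    rw [mul_one_div, div_le_div_iff₀ (by positivity) (by positivity), one_mul, ← mul_pow]
    gcongr
    linarith
  have hge (z : ℂ) : 1 / massRadius μ z ^ 2 ≤
      4 ^ 2 * (1 / massRadius (spreadMeasure μ) z ^ 2) := by
    have h1 := (massRadius_spreadMeasure_mem hdoubling hne z).2
    have h2 := hρ z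
    have h3 := hρ' z
    rw [mul_one_div, div_le_div_iff₀ (by positivity) (by positivity), one_mul, ← mul_pow]
    gcongr
  refine ⟨regularization φ μ, spreadMeasure μ, hψ, hψ.subharmonic hΔ0,
    exists_regularization_sub_le hdoubling hne hφ hμ, hν, hd', ⟨?_, ?_⟩, ⟨?_, ?_⟩, ?_⟩
  · refine ⟨C₁ * 4 ^ 2, by positivity, fun z => ?_⟩
    rw [hΔ, mul_assoc]
    refine (hC₁ z).trans ?_
    rw [div_eq_mul_one_div]
    exact mul_le_mul_of_nonneg_left (hge z) hC₁0.le
  · refine ⟨c⁻¹ * 16 ^ 2, by positivity, fun z => ?_⟩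
    rw [hΔ]
    refine (hle z).trans ?_
    have h1 := hc z
    rw [div_eq_mul_one_div] at h1
    calc _ = c⁻¹ * 16 ^ 2 * (c * (1 / massRadius μ z ^ 2)) := by field_simp
      _ ≤ _ := by gcongr
  · exact ⟨16 ^ 2, by positivity, hle⟩
  · exact ⟨4 ^ 2, by positivity, hge⟩
  · refine ⟨C₃, hC₃0, fun z => ?_⟩
    simp only [hΔ]
    rw [gradient, LinearIsometryEquiv.norm_map, mul_one_div]
    exact hC₃ z
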